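/- Let $Y_{333}$ be the graph with ten nodes $a, b_i, c_i, d_i$ ($i\in\{1,2,3\}$) and the nine edges $ab_i$, $b_ic_i$, $c_id_i$. Let $G$ be a group (finite or infinite) of order greater than $2$, generated by elements, denoted by the same letters as the nodes of $Y_{333}$, that satisfy the Coxeter relations of $Y_{333}$: $x^2=1$ for every node $x$, $(xy)^3=1$ if $x,y$ are joined, and $(xy)^2=1$ if $x\neq y$ are not joined. Let $L$ be the free abelian group on the nodes of $Y_{333}$, with the symmetric bilinear form for which every node has norm $2$ and two distinct nodes have inner product $-1$ if they are joined and $0$ otherwise. Define a set $R$ of pairs $(v,g)$ with $v\in L$ (a root) and $g\in G$ (the element corresponding to it) as the smallest set such that: (i) for every node $x$ of $Y_{333}$, the pair formed by the basis vector $x$ and the generator $x$ is in $R$; (ii) if $(v,g)\in R$ then $(-v,g)\in R$; (iii) if $(v_1,g_1),\dots,(v_7,g_7)\in R$ and the $v_k$ form an $a_7$ chain, that is, $(v_k,v_k)=2$, $(v_k,v_{k+1})=-1$ and $(v_j,v_k)=0$ for $|j-k|\geq 2$, then the affine $A_7$ extending root with its element, $\bigl(-(v_1+\dots+v_7),\ g_1^{\,g_2g_3\cdots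 g_7}\bigr)$, is in $R$, where $x^y=y^{-1}xy$. The closure $\Gamma$ of $Y_{333}$ under adjoining affine $A_7$ extending nodes is the graph whose nodes are the elements $g\in G$ with $(v,g)\in R$ for some $v$ (so roots corresponding to the same element of $G$ share a node); two distinct nodes $g,h$ are joined if there are $(v,g),(w,h)\in R$ with $(v,w)=\pm1$. For $\{i,j,k\}=\{1,2,3\}$, with $(i,j,k)$ a cyclic permutation of $(1,2,3)$, let $a_k\in G$ be the extending node of the chain $d_i, c_i, b_i, a, b_j, c_j, d_j$, and let $z_k\in G$ be the extending node of the chain $c_i, d_i, a_j, d_k, a_i, d_j, c_j$, where the extending node of $\alpha_1,\dots,\alpha_7$ is $\alpha_1^{\,\alpha_2\cdots\alpha_7}$. Suppose that $\Gamma$ has at most $14$ nodes. Then: 1. $\Gamma$ has exactly $14$ nodes and is isomorphic to the incidence graph of the projective plane of order $2$ (the Fano plane), and the nodes of $\Gamma$, as elements of $G$, satisfy the Coxeter relations of $\Gamma$; 2. $z_1=z_2=z_3$ in $G$; 3. $G\cong O_8^-(2){:}2$, the full orthogonal group of a nondegenerate quadratic form of minus type (Witt index $3$) on $\mathbb{F}_2^8$,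 for instance $x_0x_1+x_2x_3+x_4x_5+x_6^2+x_6x_7+x_7^2$. -/

import Mathlib

namespace Deflate

/-! ### Coxeter relations of a graph -/

/-- The elements `f v` of `G` satisfy the Coxeter relations of the graph `Γ`. -/
def SatisfiesCoxeter {V G : Type*} [Group G] (Γ : SimpleGraph V) (f : V → G) : Prop :=
  (∀ v, f v ^ 2 = 1) ∧
  (∀ v w, Γ.Adj v w → (f v * f w) ^ 3 = 1) ∧
  (∀ v w, v ≠ w → ¬ Γ.Adj v w → (f v * f w) ^ 2 = 1)

/-! ### The `Y₃₃₃` diagram -/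

/-- The ten nodes of the `Y₃₃₃` diagram: the centre `a`, and three arms `bᵢ, cᵢ, dᵢ`
(the index set `{1, 2, 3}` is replaced by `Fin 3 = {0, 1, 2}`). -/
abbrev Node : Type := Option (Fin 3 × Fin 3)

/-- The central node. -/
def na : Node := none
/-- The node of arm `i` next to the centre. -/
def nb (i : Fin 3) : Node := some (i, 0)
/-- The middle node of arm `i`. -/
def nc (i : Fin 3) : Node := some (i, 1)
/-- The outer node of arm `i`. -/
def nd (i : Fin 3) : Node := some (i, 2)

/-- The `Y₃₃₃` diagram: three chains `a — bᵢ — cᵢ — dᵢ` with the common end `a`. -/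
def y333 : SimpleGraph Node :=
  SimpleGraph.fromRel fun x y =>
    ∃ i, (x = na ∧ y = nb i) ∨ (x = nb i ∧ y = nc i) ∨ (x = nc i ∧ y = nd i)

instance : DecidableRel y333.Adj := fun x y =>
  decidable_of_iff _ (SimpleGraph.fromRel_adj _ x y).symm

/-- The Gram matrix of the fundamental roots of `Y₃₃₃`: norm `2`, inner product `-1` for joined
and `0` for unjoined nodes. -/
def gram : Matrix Node Node ℤ :=
  Matrix.of fun i j => if i = j then 2 else if y333.Adj i j then -1 else 0

/-- The inner product on the root lattice of `Y₃₃₃`, the free abelian group on the nodes. -/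
def ip (v w : Node → ℤ) : ℤ := dotProduct v (gram.mulVec w)

/-! ### Adjoining affine `A₇` extending nodes -/

/-- The element `α₁ ^ (α₂ ⋯ α₇) = (α₂ ⋯ α₇)⁻¹ α₁ (α₂ ⋯ α₇)`; the list `α₁, …, α₇` is
indexed by `0, …, 6`. -/
def extElt {G : Type*} [Group G] (g : Fin 7 → G) : G :=
  (g 1 * g 2 * g 3 * g 4 * g 5 * g 6)⁻¹ * g 0 * (g 1 * g 2 * g 3 * g 4 * g 5 * g 6)

/-- `IsRoot s v g`: the vector `v` is a root obtained from the fundamental roots of `Y₃₃₃` by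
repeatedly adjoining `A₇` extending roots, and `g` is the corresponding element of `G`, where the
fundamental roots correspond to the generators `s`.

A root and its negative give the same element. If `v₁, …, v₇` are such roots whose inner products
are those of an `a₇` chain, the extending root is `-(v₁ + ⋯ + v₇)`, and it corresponds to
`g₁ ^ (g₂ ⋯ g₇)`. -/
inductive IsRoot {G : Type*} [Group G] (s : Node → G) : (Node → ℤ) → G → Prop
  | base (i : Node) : IsRoot s (Pi.single i 1) (s i)
  | neg (v : Node → ℤ) (g : G) : IsRoot s v g → IsRoot s (-v) g
  | extend (v : Fin 7 → Node → ℤ) (g : Fin 7 → G) :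
      (∀ k, IsRoot s (v k) (g k)) →
      (∀ j k, ip (v j) (v k) = CartanMatrix.A 7 j k) →
      IsRoot s (-∑ k, v k) (extElt g)

/-- The nodes of the closure of `Y₃₃₃` under adjoining `A₇` extending nodes. Roots that correspond
to the same element of `G` share a node, so that the nodes are elements of `G`. -/
def closureNodes {G : Type*} [Group G] (s : Node → G) : Set G :=
  {g | ∃ v, IsRoot s v g}

/-- The closure as a graph: two distinct nodes are joined when they are represented by roots with
inner product `1` or `-1`. -/
def closureGraph {G : Type*} [Group G] (s : Node → G) : SimpleGraph (closureNodes s) :=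
  SimpleGraph.fromRel fun x y =>
    ∃ v w, IsRoot s v x ∧ IsRoot s w y ∧ (ip v w = 1 ∨ ip v w = -1)

/-- The extending node `aₖ` of the chain `dᵢ — cᵢ — bᵢ — a — bⱼ — cⱼ — dⱼ`, where
`{i, j, k}` is the index set. -/
def aElt {G : Type*} [Group G] (s : Node → G) (k : Fin 3) : G :=
  extElt ![s (nd (k + 1)), s (nc (k + 1)), s (nb (k + 1)), s na,
    s (nb (k + 2)), s (nc (k + 2)), s (nd (k + 2))]

/-- The extending node `zₖ` of the chain `cᵢ — dᵢ — aⱼ — dₖ — aᵢ — dⱼ — cⱼ`, where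
`{i, j, k}` is the index set. -/
def zElt {G : Type*} [Group G] (s : Node → G) (k : Fin 3) : G :=
  extElt ![s (nc (k + 1)), s (nd (k + 1)), aElt s (k + 2), s (nd k),
    aElt s (k + 1), s (nd (k + 2)), s (nc (k + 2))]

/-! ### The incidence graph of the Fano plane -/

/-- The nonzero vectors of `𝔽₂³`. They are the points of the projective plane of order 2, and, as
coordinate vectors of linear equations, also its lines. -/
abbrev FanoPt : Type := {v : Fin 3 → ZMod 2 // v ≠ 0}

/-- The incidence graph of the projective plane of order 2: points on the left, lines on the
right, the point `p` being joined to the line `l` when `p` lies on `l`. -/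
def fanoIncidence : SimpleGraph (FanoPt ⊕ FanoPt) :=
  SimpleGraph.fromRel fun x y =>
    ∃ p l : FanoPt, x = Sum.inl p ∧ y = Sum.inr l ∧ dotProduct l.1 p.1 = 0

/-! ### The group `O₈⁻(2):2` -/

/-- The nondegenerate quadratic form `x₀x₁ + x₂x₃ + x₄x₅ + (x₆² + x₆x₇ + x₇²)` on `𝔽₂⁸`, of
minus type (Witt index 3). -/
def qMinus : QuadraticForm (ZMod 2) (Fin 8 → ZMod 2) :=
  QuadraticMap.proj 0 1 + QuadraticMap.proj 2 3 + QuadraticMap.proj 4 5 +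
    (QuadraticMap.proj 6 6 + QuadraticMap.proj 6 7 + QuadraticMap.proj 7 7)

/-- The full orthogonal group of `qMinus`, the group `O₈⁻(2):2` in Atlas notation: the simple group
`O₈⁻(2)` is its subgroup of index 2. -/
def O8Minus2 : Subgroup ((Fin 8 → ZMod 2) ≃ₗ[ZMod 2] (Fin 8 → ZMod 2)) where
  carrier := {f | ∀ x, qMinus (f x) = qMinus x}
  mul_mem' := by
    intro f g hf hg x
    rw [LinearEquiv.mul_apply, hf, hg]
  one_mem' := fun _ => rfl
  inv_mem' := by
    intro f hf x
    have h := hf (f⁻¹ x)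
    rw [← LinearEquiv.mul_apply, mul_inv_cancel] at h
    exact h.symm

end Deflate

/-! The proof has three stages.

Roots. The vectors reached by adjoining extending roots are real roots of the Coxeter group of
`y333`, since an extending root is, up to sign, the image of one end of its chain under the
reflections in the other six members. Because the generators satisfy the Coxeter relations, the
element of `G` attached to a real root depends only on the root (`RootElt.unique`), and reflecting a
root conjugates its element (`RootElt.reflect`). Hence elements of orthogonal roots have a product
of order dividing 2, and those of roots with inner product `±1` a product of order dividing 3.

Counting. If the elements of two roots agree, any root orthogonal to one and joined to the other has
that element too (`eq_of_sq_of_cube`). Unless both roots are among the `zₖ`, this spreads until all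
ten generators are equal and `G` has order at most 2 (`namedElt_ne`). So the ten generators, the
three `aₖ` and any one `zₖ` are fourteen different nodes. A bound of 14 forces the `zₖ` to coincide
and leaves room for no other node. The incidences are then read off from inner products.

Identification of `G`. Reducing the root lattice modulo 2 and dividing by the differences of the
`zₖ` gives `𝔽₂⁸` with the form `qMinus`, and roots become vectors `v` with `qMinus v = 1`. Let `K`
be the subgroup of `G × GL₈(2)` generated by the pairs (element of a root, transvection of its
image), for fourteen roots (`pairGroup`). `K` turns out to be the graph of an isomorphism: - its
projection to `GL₈(2)` is injective, because coset enumerations along a chain of stabilizers of base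
vectors, using only relations known in `K`, reach the trivial subgroup (`eq_one_of_mem_pairGroup`);
- the image is the whole orthogonal group, because each orbit in the chain contains every vector to
which an isometry fixing the earlier base vectors could move the next one (`exists_snd_eq`); - its
projection to `G` is onto, and injective because a kernel element would force two distinct nodes to
coincide (`eq_one_of_fst_eq_one`). -/

namespace Deflate

/-! ### The inner product -/

theorem ip_smul_left (c : ℤ) (v w : Node → ℤ) : ip (c • v) w = c * ip v w :=
  smul_dotProduct _ _ _

theorem ip_neg_left (v w : Node → ℤ) : ip (-v) w = -ip v w :=
  neg_dotProduct _ _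

theorem ip_sub_left (u v w : Node → ℤ) : ip (u - v) w = ip u w - ip v w :=
  sub_dotProduct _ _ _

theorem gram_transpose : gram.transpose = gram := by
  ext i j
  simp only [gram, Matrix.transpose_apply, Matrix.of_apply, eq_comm (a := j), y333.adj_comm j i]

theorem ip_comm (v w : Node → ℤ) : ip v w = ip w v := by
  unfold ip
  rw [Matrix.dotProduct_mulVec, ← Matrix.mulVec_transpose, gram_transpose, dotProduct_comm]

theorem ip_neg_right (v w : Node → ℤ) : ip v (-w) = -ip v w := by
  rw [ip_comm, ip_neg_left, ip_comm]

theorem ip_sub_right (u v w : Node → ℤ) : ip u (v - w) = ip u v - ip u w := by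
  rw [ip_comm, ip_sub_left, ip_comm v, ip_comm w]

theorem ip_smul_right (c : ℤ) (v w : Node → ℤ) : ip v (c • w) = c * ip v w := by
  rw [ip_comm, ip_smul_left, ip_comm]

/-- The fundamental root of a node. -/
def simpleRoot (i : Node) : Node → ℤ := Pi.single i 1

theorem simpleRoot_same (i : Node) : simpleRoot i i = 1 := Pi.single_eq_same _ _

theorem simpleRoot_ne {i j : Node} (h : j ≠ i) : simpleRoot i j = 0 := Pi.single_eq_of_ne h _

theorem ip_simpleRoot (i j : Node) : ip (simpleRoot i) (simpleRoot j) = gram i j := by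
  simp [ip, simpleRoot]

theorem ip_simpleRoot_self (i : Node) : ip (simpleRoot i) (simpleRoot i) = 2 := by
  simp [ip_simpleRoot, gram]

theorem ip_simpleRoot_adj {i j : Node} (h : y333.Adj i j) :
    ip (simpleRoot i) (simpleRoot j) = -1 := by
  simp [ip_simpleRoot, gram, h, h.ne]

theorem ip_simpleRoot_not_adj {i j : Node} (hij : i ≠ j) (h : ¬ y333.Adj i j) :
    ip (simpleRoot i) (simpleRoot j) = 0 := by
  simp [ip_simpleRoot, gram, h, hij]

theorem ip_simpleRoot_nonpos {i j : Node} (hij : i ≠ j) :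
    ip (simpleRoot i) (simpleRoot j) ≤ 0 := by
  by_cases h : y333.Adj i j
  · simp [ip_simpleRoot_adj h]
  · simp [ip_simpleRoot_not_adj hij h]

/-- The reflection of `v` in the root `r`. -/
def reflect (r v : Node → ℤ) : Node → ℤ := v - ip v r • r

/-! ### Involutions -/

section Involutions

variable {G : Type*} [Group G]

theorem commute_of_sq {x y : G} (hy : y * y = 1) (h : (x * y) ^ 2 = 1) :
    x * y * x = y := by
  have h1 : x * y * x * y = 1 := by rw [← h, pow_two]; group
  have h2 : x * y * x = y⁻¹ := eq_inv_of_mul_eq_one_left h1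
  rw [h2, inv_eq_of_mul_eq_one_left hy]

theorem braid_of_cube {x y : G} (hx : x * x = 1) (hy : y * y = 1) (h : (x * y) ^ 3 = 1) :
    x * y * x = y * x * y := by
  have h1 : (x * y * x) * (y * x * y) = 1 := by rw [← h, pow_succ, pow_two]; group
  have h2 : x * y * x = (y * x * y)⁻¹ := eq_inv_of_mul_eq_one_left h1
  rw [h2]
  simp only [mul_inv_rev, inv_eq_of_mul_eq_one_left hx, inv_eq_of_mul_eq_one_left hy, mul_assoc]

theorem mul_sq_of_commute {x y : G} (hy : y * y = 1) (h : x * y * x = y) : (x * y) ^ 2 = 1 := by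
  rw [pow_two, ← mul_assoc, h, hy]

theorem mul_cube_of_braid {x y : G} (hx : x * x = 1) (hy : y * y = 1)
    (h : x * y * x = y * x * y) : (x * y) ^ 3 = 1 := by
  have : (x * y) ^ 3 = (x * y * x) * (y * x * y) := by rw [pow_succ, pow_two]; group
  rw [this, h]
  calc y * x * y * (y * x * y) = y * x * (y * y) * x * y := by group
    _ = 1 := by rw [hy, mul_one, mul_assoc y x x, hx, mul_one, hy]

/-- Every collapse argument ends here: an element that is related to another both as an orthogonal
root and as a joined root must equal it. -/
theorem eq_of_sq_of_cube {x y : G} (hy : y * y = 1) (h2 : (x * y) ^ 2 = 1)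
    (h3 : (x * y) ^ 3 = 1) : x = y := by
  rw [pow_succ, h2, one_mul] at h3
  rw [eq_inv_of_mul_eq_one_left h3, inv_eq_of_mul_eq_one_left hy]

end Involutions

/-! ### Positive roots and their elements -/

section Roots

variable {G : Type*} [Group G] {s : Node → G}

/-- `UpRoot s v g`: the positive root `v` arises from a fundamental root by fundamental
reflections that increase the height, and `g` is the conjugate of a generator obtained by the
corresponding conjugations. -/
inductive UpRoot (s : Node → G) : (Node → ℤ) → G → Prop
  | base (i : Node) : UpRoot s (simpleRoot i) (s i)
  | step (i : Node) (v : Node → ℤ) (g : G) : UpRoot s v g → ip v (simpleRoot i) < 0 →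
      UpRoot s (reflect (simpleRoot i) v) (s i * g * s i)

/-- The sum of the coordinates. -/
def height (v : Node → ℤ) : ℤ := ∑ i, v i

theorem height_reflect (i : Node) (v : Node → ℤ) :
    height (reflect (simpleRoot i) v) = height v - ip v (simpleRoot i) := by
  simp [height, reflect, simpleRoot, Finset.sum_sub_distrib, Pi.single_apply]

/-- A positive height is what allows induction on `(height v).toNat`, and it prevents `v` and `-v`
from both being positive roots. -/
theorem UpRoot.nonneg {v : Node → ℤ} {g : G} (h : UpRoot s v g) : 0 ≤ v ∧ 0 < height v := by
  induction h with
  | base i =>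
    constructor
    · exact Pi.single_nonneg.2 zero_le_one
    · simp [height, simpleRoot]
  | step i v g _ hi ih =>
    constructor
    · intro j
      have := ih.1 j
      by_cases hj : j = i
      · subst hj
        simp only [reflect, Pi.sub_apply, Pi.smul_apply, simpleRoot_same, Pi.zero_apply,
          smul_eq_mul] at *
        linarith
      · simpa [reflect, simpleRoot_ne hj] using this
    · rw [height_reflect]; linarith [ih.2]

theorem UpRoot.mul_self (hs : ∀ i, s i * s i = 1) {v : Node → ℤ} {g : G} (h : UpRoot s v g) :
    g * g = 1 := by
  induction h with
  | base i => exact hs i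
  | step i v g _ _ ih =>
    calc s i * g * s i * (s i * g * s i) = s i * g * (s i * s i) * g * s i := by group
      _ = 1 := by rw [hs, mul_one, mul_assoc (s i), ih, mul_one, hs]

theorem reflect_ne_simpleRoot {v : Node → ℤ} {g : G} (h : UpRoot s v g) {i : Node}
    (hi : ip v (simpleRoot i) < 0) (j : Node) : reflect (simpleRoot i) v ≠ simpleRoot j := by
  intro he
  have hh := congrArg height he
  rw [height_reflect] at hh
  have h1 : height (simpleRoot j) = 1 := by simp [height, simpleRoot]
  have := h.nonneg.2
  linarith [Int.add_one_le_iff.2 hi, Int.add_one_le_iff.2 this]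

theorem UpRoot.eq_of_simpleRoot {g : G} {j : Node} (h : UpRoot s (simpleRoot j) g) : g = s j := by
  generalize hv : simpleRoot j = v at h
  cases h with
  | base i =>
    have : i = j := by
      by_contra hne
      have := congrFun hv i
      rw [simpleRoot_ne hne, simpleRoot_same] at this
      exact zero_ne_one this
    rw [this]
  | step i v' g' h' hi => exact absurd hv.symm (reflect_ne_simpleRoot h' hi j)

theorem reflect_reflect_simpleRoot (i : Node) (v : Node → ℤ) :
    reflect (simpleRoot i) (reflect (simpleRoot i) v) = v := by
  simp only [reflect, ip_sub_left, ip_smul_left, ip_simpleRoot_self]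
  module

theorem conj_conj {x : G} (hx : x * x = 1) (g : G) : x * (x * g * x) * x = g := by
  calc x * (x * g * x) * x = (x * x) * g * (x * x) := by group
    _ = g := by rw [hx, one_mul, mul_one]

/-! ### The element of a positive root is well defined -/

section Coxeter

variable (hcox : SatisfiesCoxeter y333 s)
include hcox

theorem SatisfiesCoxeter.mul_self (i : Node) : s i * s i = 1 := by
  rw [← pow_two]; exact hcox.1 i

theorem SatisfiesCoxeter.conj_of_not_adj {i j : Node} (hij : i ≠ j) (h : ¬ y333.Adj i j) :
    s i * s j * s i = s j :=
  commute_of_sq (hcox.mul_self j) (hcox.2.2 i j hij h)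

theorem SatisfiesCoxeter.braid {i j : Node} (h : y333.Adj i j) :
    s i * s j * s i = s j * s i * s j :=
  braid_of_cube (hcox.mul_self i) (hcox.mul_self j) (hcox.2.1 i j h)

/-- A fundamental reflection that lowers the height of a positive root other than its own root
leads to a positive root. -/
theorem UpRoot.descend {v : Node → ℤ} {g : G} (h : UpRoot s v g) {j : Node}
    (hne : v ≠ simpleRoot j) (hj : 0 < ip v (simpleRoot j)) :
    UpRoot s (reflect (simpleRoot j) v) (s j * g * s j) := by
  induction hn : (height v).toNat using Nat.strong_induction_on generalizing v g j with
  | _ n ih =>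
  cases h with
  | base k =>
    have hkj : k ≠ j := fun h => hne (by rw [h])
    exact absurd hj (not_lt.2 (ip_simpleRoot_nonpos hkj))
  | step i v g h hi =>
    have hlt : (height v).toNat < n := by
      have := h.nonneg.2
      rw [height_reflect] at hn
      omega
    by_cases hij : i = j
    · subst hij
      rw [reflect_reflect_simpleRoot, conj_conj (hcox.mul_self i)]
      exact h
    have hjv : ip (reflect (simpleRoot i) v) (simpleRoot j)
        = ip v (simpleRoot j) - ip v (simpleRoot i) * ip (simpleRoot i) (simpleRoot j) := by
      rw [reflect, ip_sub_left, ip_smul_left]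
    by_cases hadj : y333.Adj i j
    · have h1 := ip_simpleRoot_adj hadj
      have h2 := ip_simpleRoot_adj hadj.symm
      have h3 := ip_simpleRoot_self i
      have h4 := ip_simpleRoot_self j
      rw [hjv, h1] at hj
      by_cases hvj : v = simpleRoot j
      · subst hvj
        have hg := h.eq_of_simpleRoot
        subst hg
        have e1 : reflect (simpleRoot j) (reflect (simpleRoot i) (simpleRoot j))
            = simpleRoot i := by
          simp only [reflect, ip_sub_left, ip_smul_left, h1, h2, h4]
          module
        have e2 : s j * (s i * s j * s i) * s j = s i := by
          rw [← hcox.braid hadj.symm, conj_conj (hcox.mul_self j)]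
        rw [e1, e2]
        exact .base i
      -- Lower `v` by `j` and then by `i`, and climb back by `j` and `i`: the braid relation gives
      -- `sᵢsⱼsᵢsⱼ = sⱼsᵢ`, so this path ends at the root and the element wanted.
      · have k1 := ih _ hlt h hvj (by linarith) rfl
        have hlt2 : (height (reflect (simpleRoot j) v)).toNat < n := by
          rw [height_reflect]
          omega
        have i1 : ip (reflect (simpleRoot j) v) (simpleRoot i)
            = ip v (simpleRoot i) + ip v (simpleRoot j) := by
          rw [reflect, ip_sub_left, ip_smul_left, h2]; ring
        have k2 := ih _ hlt2 k1 (j := i) (by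
          intro he
          have e1 := congrArg (fun w => ip w (simpleRoot i)) he
          have e2 := congrArg (fun w => ip w (simpleRoot j)) he
          simp only [reflect, ip_sub_left, ip_smul_left, h1, h2, h3, h4] at e1 e2
          linarith) (by linarith) rfl
        have k3 := k2.step j _ _ (by
          simp only [reflect, ip_sub_left, ip_smul_left, h1, h2, h4]
          linarith)
        have k4 := k3.step i _ _ (by
          simp only [reflect, ip_sub_left, ip_smul_left, h1, h2, h3, h4]
          linarith)
        convert k4 using 1
        · simp only [reflect, ip_sub_left, ip_smul_left, h1, h2, h3, h4]
          module
        · have hb := hcox.braid hadj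
          have : s i * (s j * (s i * (s j * g * s j) * s i) * s j) * s i
              = (s i * s j * s i) * (s j * g * s j) * (s i * s j * s i) := by group
          rw [this, hb]
          calc s j * (s i * g * s i) * s j
              = s j * s i * 1 * g * 1 * s i * s j := by group
            _ = s j * s i * (s j * s j) * g * (s j * s j) * s i * s j := by rw [hcox.mul_self j]
            _ = _ := by group
    · have h1 := ip_simpleRoot_not_adj hij hadj
      have h2 := ip_simpleRoot_not_adj (Ne.symm hij) (fun h => hadj h.symm)
      rw [hjv, h1] at hj
      have hvj : v ≠ simpleRoot j := by
        rintro rfl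
        rw [h2] at hi
        exact lt_irrefl _ hi
      have k1 := ih _ hlt h hvj (by linarith) rfl
      have k2 := k1.step i _ _ (by
        simp only [reflect, ip_sub_left, ip_smul_left, h2]
        linarith)
      convert k2 using 1
      · simp only [reflect, ip_sub_left, ip_smul_left, h1, h2]
        module
      · have hc : s i * s j = s j * s i := by
          have := hcox.conj_of_not_adj hij hadj
          calc s i * s j = s i * s j * (s i * s i) := by rw [hcox.mul_self, mul_one]
            _ = _ := by rw [← mul_assoc, this]
        calc s j * (s i * g * s i) * s j = (s j * s i) * g * (s i * s j) := by group
          _ = (s i * s j) * g * (s j * s i) := by rw [hc]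
          _ = _ := by group

/-- The last step of one derivation can be undone starting from any other derivation, since
`UpRoot.descend` does not depend on how the root was reached. The root system is infinite, and only
heights are used. -/
theorem UpRoot.unique {v : Node → ℤ} {g g' : G} (h : UpRoot s v g) (h' : UpRoot s v g') :
    g = g' := by
  induction h generalizing g' with
  | base i => exact h'.eq_of_simpleRoot.symm
  | step i v g h hi ih =>
    have := h'.descend hcox (reflect_ne_simpleRoot h hi i) (by
      rw [reflect, ip_sub_left, ip_smul_left, ip_simpleRoot_self]; linarith)
    rw [reflect_reflect_simpleRoot] at this
    rw [ih this, conj_conj (hcox.mul_self i)]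

theorem UpRoot.conj_of_ip_eq_zero {v : Node → ℤ} {g : G} (h : UpRoot s v g) {j : Node}
    (hj : ip v (simpleRoot j) = 0) : s j * g * s j = g := by
  induction hn : (height v).toNat using Nat.strong_induction_on generalizing v g j with
  | _ n ih =>
  cases h with
  | base k =>
    have hkj : k ≠ j := by
      rintro rfl
      rw [ip_simpleRoot_self] at hj
      exact two_ne_zero hj
    refine hcox.conj_of_not_adj hkj.symm fun ha => ?_
    rw [ip_simpleRoot_adj ha.symm] at hj
    exact absurd hj (by decide)
  | step i v g h hi =>
    have hpos := h.nonneg.2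
    have hlt : (height v).toNat < n := by
      rw [height_reflect] at hn
      omega
    rw [reflect, ip_sub_left, ip_smul_left] at hj
    by_cases hij : i = j
    · subst hij
      rw [ip_simpleRoot_self] at hj
      omega
    by_cases hadj : y333.Adj i j
    · have h1 := ip_simpleRoot_adj hadj
      have h2 := ip_simpleRoot_adj hadj.symm
      rw [h1] at hj
      have hvj : v ≠ simpleRoot j := by
        rintro rfl
        rw [h2, ip_simpleRoot_self] at hj
        omega
      -- Orthogonality of the reflected root to `simpleRoot j` means `ip v (simpleRoot j) = -ip v
      -- (simpleRoot i) > 0`. So `v` can be lowered by `j`; the result is orthogonal to `simpleRoot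
      -- i`, and the braid relation turns commutation with `s i` into commutation with `s j`.
      have k1 := h.descend hcox hvj (by linarith)
      have k2 := ih _ (by rw [height_reflect]; omega) k1 (j := i) (by
        rw [reflect, ip_sub_left, ip_smul_left, h2]; linarith) rfl
      have hb := hcox.braid hadj
      calc s j * (s i * g * s i) * s j
          = s j * s i * 1 * g * 1 * s i * s j := by group
        _ = s j * s i * (s j * s j) * g * (s j * s j) * s i * s j := by rw [hcox.mul_self j]
        _ = (s j * s i * s j) * (s j * g * s j) * (s j * s i * s j) := by group
        _ = (s i * s j * s i) * (s j * g * s j) * (s i * s j * s i) := by rw [hb]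
        _ = s i * s j * (s i * (s j * g * s j) * s i) * s j * s i := by group
        _ = s i * (s j * (s j * g * s j) * s j) * s i := by rw [k2]; group
        _ = s i * g * s i := by rw [conj_conj (hcox.mul_self j)]
    · rw [ip_simpleRoot_not_adj hij hadj] at hj
      have k := ih _ hlt h (j := j) (by linarith) rfl
      have hc : s i * s j = s j * s i := by
        have := hcox.conj_of_not_adj hij hadj
        calc s i * s j = s i * s j * (s i * s i) := by rw [hcox.mul_self, mul_one]
          _ = _ := by rw [← mul_assoc, this]
      calc s j * (s i * g * s i) * s j = (s j * s i) * g * (s i * s j) := by group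
        _ = (s i * s j) * g * (s j * s i) := by rw [hc]
        _ = s i * (s j * g * s j) * s i := by group
        _ = _ := by rw [k]

end Coxeter

/-- The element `g` corresponds to the positive or negative root `v`. -/
def RootElt (s : Node → G) (v : Node → ℤ) (g : G) : Prop := UpRoot s v g ∨ UpRoot s (-v) g

theorem reflect_neg (r v : Node → ℤ) : reflect r (-v) = -reflect r v := by
  simp only [reflect, ip_neg_left]; module

theorem reflect_neg_root (r v : Node → ℤ) : reflect (-r) v = reflect r v := by
  simp only [reflect, ip_neg_right]; module

theorem RootElt.neg {v : Node → ℤ} {g : G} (h : RootElt s v g) : RootElt s (-v) g := by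
  rcases h with h | h
  · right; rwa [neg_neg]
  · left; exact h

/-! ### Reflections in arbitrary roots and the relations between root elements -/

section Coxeter

variable (hcox : SatisfiesCoxeter y333 s)
include hcox

theorem RootElt.unique {v : Node → ℤ} {g g' : G} (h : RootElt s v g) (h' : RootElt s v g') :
    g = g' := by
  have key : ∀ {v g g'}, UpRoot s v g → UpRoot s (-v) g' → g = g' := by
    intro v g g' h h'
    have h1 := h.nonneg.2
    have h2 := h'.nonneg.2
    have : height (-v) = -height v := by simp [height]
    omega
  rcases h with h | h <;> rcases h' with h' | h'
  · exact h.unique hcox h'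
  · exact key h h'
  · exact (key h' h).symm
  · exact h.unique hcox h'

theorem RootElt.mul_self {v : Node → ℤ} {g : G} (h : RootElt s v g) : g * g = 1 := by
  rcases h with h | h <;> exact UpRoot.mul_self hcox.mul_self h

/-- The only positive root that a fundamental reflection makes negative is its own. For any other,
the sign of the inner product decides between climbing, commuting and descending. -/
theorem RootElt.reflect_simpleRoot {v : Node → ℤ} {g : G} (h : RootElt s v g) (i : Node) :
    RootElt s (reflect (simpleRoot i) v) (s i * g * s i) := by
  have key : ∀ {v g}, UpRoot s v g → RootElt s (reflect (simpleRoot i) v) (s i * g * s i) := by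
    intro v g h
    by_cases hv : v = simpleRoot i
    · subst hv
      right
      have e : -reflect (simpleRoot i) (simpleRoot i) = simpleRoot i := by
        simp only [reflect, ip_simpleRoot_self]; module
      rw [e, h.eq_of_simpleRoot, hcox.mul_self, one_mul]
      exact .base i
    left
    rcases lt_trichotomy (ip v (simpleRoot i)) 0 with hi | hi | hi
    · exact h.step i _ _ hi
    · rw [h.conj_of_ip_eq_zero hcox hi, reflect, hi, zero_smul, sub_zero]
      exact h
    · exact h.descend hcox hv hi
  rcases h with h | h
  · exact key h
  · have := (key h).neg
    rwa [reflect_neg, neg_neg] at this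

/-- The reflection in `sᵢ r` is the conjugate by `sᵢ` of the reflection in `r`, so induction on the
derivation of `r` reduces to fundamental reflections. -/
theorem RootElt.reflect {r v : Node → ℤ} {g h : G} (hr : RootElt s r g) (hv : RootElt s v h) :
    RootElt s (reflect r v) (g * h * g) := by
  have key : ∀ {r g}, UpRoot s r g → ∀ {v h}, RootElt s v h →
      RootElt s (Deflate.reflect r v) (g * h * g) := by
    intro r g hr
    induction hr with
    | base i => intro v h hv; exact hv.reflect_simpleRoot hcox i
    | step i r g _ _ ih =>
      intro v h hv
      have := (ih (hv.reflect_simpleRoot hcox i)).reflect_simpleRoot hcox i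
      convert this using 1
      · have h3 := ip_simpleRoot_self i
        simp only [Deflate.reflect, ip_sub_left, ip_smul_left, ip_sub_right, ip_smul_right, h3,
          ip_comm (simpleRoot i) r]
        module
      · group
  rcases hr with hr | hr
  · exact key hr hv
  · rw [← reflect_neg_root]; exact key hr hv

theorem RootElt.sq_of_ip_eq_zero {v w : Node → ℤ} {g h : G} (hv : RootElt s v g)
    (hw : RootElt s w h) (h0 : ip v w = 0) : (g * h) ^ 2 = 1 := by
  have := hv.reflect hcox hw
  rw [Deflate.reflect, ip_comm, h0, zero_smul, sub_zero] at this
  exact mul_sq_of_commute (hw.mul_self hcox) (this.unique hcox hw)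

/-- For inner product 1, reflecting `w` in `v` and `v` in `w` gives opposite roots, which share an
element; that is the braid relation. -/
theorem RootElt.cube_of_ip {v w : Node → ℤ} {g h : G} (hv : RootElt s v g)
    (hw : RootElt s w h) (h1 : ip v w = 1 ∨ ip v w = -1) : (g * h) ^ 3 = 1 := by
  have key : ∀ {v}, RootElt s v g → ip v w = 1 → (g * h) ^ 3 = 1 := by
    intro v hv h1
    have k1 := hv.reflect hcox hw
    have k2 := (hw.reflect hcox hv).neg
    have e : -Deflate.reflect w v = Deflate.reflect v w := by
      rw [Deflate.reflect, Deflate.reflect, ip_comm w v, h1]; module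
    rw [e] at k2
    exact mul_cube_of_braid (hv.mul_self hcox) (hw.mul_self hcox) (k1.unique hcox k2)
  rcases h1 with h1 | h1
  · exact key hv h1
  · exact key hv.neg (by rw [ip_neg_left, h1, neg_neg])

/-- Reflecting `v 0` successively in `v 1, …, v 6` adds one chain member each time, while the
element is conjugated in the order prescribed by `extElt`. -/
theorem RootElt.extElt {v : Fin 7 → Node → ℤ} {g : Fin 7 → G} (h : ∀ k, RootElt s (v k) (g k))
    (hip : ∀ j k, ip (v j) (v k) = CartanMatrix.A 7 j k) :
    RootElt s (∑ k, v k) (extElt g) := by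
  have hm := fun k => (h k).mul_self hcox
  have k1 := (h 1).reflect hcox (h 0)
  have k2 := (h 2).reflect hcox k1
  have k3 := (h 3).reflect hcox k2
  have k4 := (h 4).reflect hcox k3
  have k5 := (h 5).reflect hcox k4
  have k6 := (h 6).reflect hcox k5
  convert k6 using 1
  · simp only [Deflate.reflect, ip_sub_left, ip_smul_left, hip, Fin.sum_univ_seven]
    have e : ∀ j k : Fin 7, (CartanMatrix.A 7 j k : ℤ) = if j = k then 2 else
        if (j : ℕ) + 1 = k ∨ (k : ℕ) + 1 = j then -1 else 0 := fun _ _ => rfl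
    simp [e]
  · have hi := fun k => inv_eq_of_mul_eq_one_left (hm k)
    simp only [Deflate.extElt, mul_inv_rev, hi]
    group

theorem IsRoot.rootElt {v : Node → ℤ} {g : G} (h : IsRoot s v g) : RootElt s v g := by
  induction h with
  | base i => exact Or.inl (.base i)
  | neg v g _ ih => exact ih.neg
  | extend v g _ hip ih => exact (RootElt.extElt hcox ih hip).neg

end Coxeter

end Roots

/-! ### Coordinate lists -/

/-- The position of a node in coordinate lists, which follow the order
`a, b₀, c₀, d₀, b₁, c₁, d₁, b₂, c₂, d₂`. -/
def nodeIndex : Node → ℕ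
  | none => 0
  | some (i, j) => 1 + 3 * i + j

/-- The vector with a given list of coordinates. -/
def ofCoords (l : List ℤ) : Node → ℤ := fun n => l.getD (nodeIndex n) 0

/-- The inner product in coordinates. -/
def ipCoords : List ℤ → List ℤ → ℤ
  | [a, b, c, d, e, f, g, h, i, j], [a', b', c', d', e', f', g', h', i', j'] =>
    a * (2 * a' - b' - e' - h') + b * (2 * b' - a' - c') + c * (2 * c' - b' - d') +
    d * (2 * d' - c') + e * (2 * e' - a' - f') + f * (2 * f' - e' - g') + g * (2 * g' - f') +
    h * (2 * h' - a' - i') + i * (2 * i' - h' - j') + j * (2 * j' - i')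
  | _, _ => 0

theorem ip_ofCoords {u v : List ℤ} (hu : u.length = 10) (hv : v.length = 10) :
    ip (ofCoords u) (ofCoords v) = ipCoords u v := by
  match u, v, hu, hv with
  | [a, b, c, d, e, f, g, h, i, j], [a', b', c', d', e', f', g', h', i', j'], _, _ =>
    have hadj : ∀ x y : Node, y333.Adj x y ↔
      (x, y) ∈ ([(na, nb 0), (na, nb 1), (na, nb 2), (nb 0, nc 0), (nb 1, nc 1), (nb 2, nc 2),
        (nc 0, nd 0), (nc 1, nd 1), (nc 2, nd 2), (nb 0, na), (nb 1, na), (nb 2, na),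
        (nc 0, nb 0), (nc 1, nb 1), (nc 2, nb 2), (nd 0, nc 0), (nd 1, nc 1),
        (nd 2, nc 2)] : List (Node × Node)) := by
      decide
    have hg : ∀ x y : Node, gram x y = if x = y then 2 else if y333.Adj x y then -1 else 0 :=
      fun _ _ => rfl
    simp [ip, dotProduct, Matrix.mulVec, Fintype.sum_option, Fintype.sum_prod_type,
      Fin.sum_univ_three, hg, hadj, na, nb, nc, nd, ofCoords, nodeIndex, ipCoords]
    ring

/-- Reflection in coordinates. -/
def reflectCoords (r v : List ℤ) : List ℤ :=
  List.zipWith (fun x y => x - ipCoords v r * y) v r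

theorem length_reflectCoords {r v : List ℤ} (hr : r.length = 10) (hv : v.length = 10) :
    (reflectCoords r v).length = 10 := by
  simp [reflectCoords, hr, hv]

theorem ofCoords_reflectCoords {r v : List ℤ} (hr : r.length = 10) (hv : v.length = 10) :
    ofCoords (reflectCoords r v) = reflect (ofCoords r) (ofCoords v) := by
  funext n
  rw [reflect, ip_ofCoords hv hr, reflectCoords]
  have hn : nodeIndex n < 10 := by revert n; decide
  simp [ofCoords, List.getD_eq_getElem?_getD, hr, hv, hn]

/-! ### The sixteen named roots -/

/-- The coordinates of the ten fundamental roots, of the extending roots `a₀, a₁, a₂` and of the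
extending roots `z₀, z₁, z₂`. These sixteen roots are referred to by their positions. -/
def namedRoots : List (List ℤ) :=
  [[1, 0, 0, 0, 0, 0, 0, 0, 0, 0], [0, 1, 0, 0, 0, 0, 0, 0, 0, 0],
   [0, 0, 1, 0, 0, 0, 0, 0, 0, 0], [0, 0, 0, 1, 0, 0, 0, 0, 0, 0],
   [0, 0, 0, 0, 1, 0, 0, 0, 0, 0], [0, 0, 0, 0, 0, 1, 0, 0, 0, 0],
   [0, 0, 0, 0, 0, 0, 1, 0, 0, 0], [0, 0, 0, 0, 0, 0, 0, 1, 0, 0],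
   [0, 0, 0, 0, 0, 0, 0, 0, 1, 0], [0, 0, 0, 0, 0, 0, 0, 0, 0, 1],
   [-1, 0, 0, 0, -1, -1, -1, -1, -1, -1], [-1, -1, -1, -1, 0, 0, 0, -1, -1, -1],
   [-1, -1, -1, -1, -1, -1, -1, 0, 0, 0], [2, 2, 2, 1, 1, 0, 0, 1, 0, 0],
   [2, 1, 0, 0, 2, 2, 1, 1, 0, 0], [2, 1, 0, 0, 1, 0, 0, 2, 2, 1]]

/-- The coordinates of the `l`-th named root. -/
def rootCoords (l : ℕ) : List ℤ := namedRoots.getD l []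

theorem length_rootCoords : ∀ l < 16, (rootCoords l).length = 10 := by decide

/-- For each named root, the set of named roots orthogonal to it, as a bit mask. -/
def orthMask (l : ℕ) : ℕ :=
  [65388, 64504, 8177, 59379, 63438, 8079, 60319, 61054, 7295, 61695, 55741, 46567, 28471, 6875,
    5851, 3803].getD l 0

/-- For each named root, the set of named roots having inner product `±1` with it, as a bit
mask. -/
def joinMask (l : ℕ) : ℕ :=
  [146, 1029, 57354, 6148, 2081, 57424, 5152, 4353, 57984, 3328, 578, 536, 200, 292, 292,
    292].getD l 0

/-- Only this direction is needed: a set bit certifies an inner product. -/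
theorem orthMask_spec : ∀ l < 16, ∀ m < 16, (orthMask l).testBit m = true →
    ipCoords (rootCoords l) (rootCoords m) = 0 := by
  decide +kernel

theorem joinMask_spec : ∀ l < 16, ∀ m < 16, (joinMask l).testBit m = true →
    ipCoords (rootCoords l) (rootCoords m) = 1 ∨ ipCoords (rootCoords l) (rootCoords m) = -1 := by
  decide +kernel

section Group

variable {G : Type*} [Group G] (s : Node → G)

/-- The elements of `G` that correspond to the named roots. -/
def namedElt : ℕ → G
  | 0 => s na
  | 1 => s (nb 0)
  | 2 => s (nc 0)
  | 3 => s (nd 0)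
  | 4 => s (nb 1)
  | 5 => s (nc 1)
  | 6 => s (nd 1)
  | 7 => s (nb 2)
  | 8 => s (nc 2)
  | 9 => s (nd 2)
  | 10 => aElt s 0
  | 11 => aElt s 1
  | 12 => aElt s 2
  | 13 => zElt s 0
  | 14 => zElt s 1
  | 15 => zElt s 2
  | _ => 1

theorem isRoot_namedElt_of_chain (l : ℕ) (c : Fin 7 → ℕ) (hc : ∀ k, c k < 16)
    (h : ∀ k, IsRoot s (ofCoords (rootCoords (c k))) (namedElt s (c k)))
    (hip : ∀ j k : Fin 7, ipCoords (rootCoords (c j)) (rootCoords (c k)) =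
      if j = k then 2 else if (j : ℕ) + 1 = k ∨ (k : ℕ) + 1 = j then -1 else 0)
    (hl : ∀ i < 10, (rootCoords l).getD i 0 = -∑ k, (rootCoords (c k)).getD i 0)
    (he : namedElt s l = extElt fun k => namedElt s (c k)) :
    IsRoot s (ofCoords (rootCoords l)) (namedElt s l) := by
  have hv : ofCoords (rootCoords l) = -∑ k, ofCoords (rootCoords (c k)) := by
    funext n
    have hn : nodeIndex n < 10 := by revert n; decide
    rw [Pi.neg_apply, Finset.sum_apply]
    exact hl _ hn
  rw [hv, he]
  refine .extend _ _ h fun j k => ?_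
  rw [ip_ofCoords (length_rootCoords _ (hc j)) (length_rootCoords _ (hc k)), hip]
  rfl

theorem isRoot_namedElt {l : ℕ} (hl : l < 16) :
    IsRoot s (ofCoords (rootCoords l)) (namedElt s l) := by
  have base : ∀ n : Node, IsRoot s (ofCoords (rootCoords (nodeIndex n))) (s n) := by
    intro n
    have : ofCoords (rootCoords (nodeIndex n)) = Pi.single n 1 := by
      revert n; decide
    rw [this]
    exact .base n
  have h0 : ∀ l < 10, IsRoot s (ofCoords (rootCoords l)) (namedElt s l) := by
    intro l hl
    interval_cases l
    · exact base na
    · exact base (nb 0)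
    · exact base (nc 0)
    · exact base (nd 0)
    · exact base (nb 1)
    · exact base (nc 1)
    · exact base (nd 1)
    · exact base (nb 2)
    · exact base (nc 2)
    · exact base (nd 2)
  -- Two rounds are needed: the chains of the `aₖ` use the first ten roots, those of the `zₖ` the
  -- first thirteen.
  have key : ∀ (m l : ℕ) (c : Fin 7 → ℕ), m ≤ 16 →
      (∀ l < m, IsRoot s (ofCoords (rootCoords l)) (namedElt s l)) → (∀ k, c k < m) →
      (∀ j k : Fin 7, ipCoords (rootCoords (c j)) (rootCoords (c k)) =
        if j = k then 2 else if (j : ℕ) + 1 = k ∨ (k : ℕ) + 1 = j then -1 else 0) →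
      (∀ i < 10, (rootCoords l).getD i 0 = -∑ k, (rootCoords (c k)).getD i 0) →
      namedElt s l = extElt (fun k => namedElt s (c k)) →
      IsRoot s (ofCoords (rootCoords l)) (namedElt s l) :=
    fun m l c hm h hc h1 h2 h3 => isRoot_namedElt_of_chain s l c
      (fun k => (hc k).trans_le hm) (fun k => h _ (hc k)) h1 h2 h3
  have h1 : ∀ l < 13, IsRoot s (ofCoords (rootCoords l)) (namedElt s l) := by
    intro l hl
    by_cases h : l < 10
    · exact h0 l h
    have : l = 10 ∨ l = 11 ∨ l = 12 := by omega
    rcases this with rfl | rfl | rfl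
    · exact key 10 10 ![6, 5, 4, 0, 7, 8, 9] (by decide) h0 (by decide) (by decide +kernel)
        (by decide +kernel) rfl
    · exact key 10 11 ![9, 8, 7, 0, 1, 2, 3] (by decide) h0 (by decide) (by decide +kernel)
        (by decide +kernel) rfl
    · exact key 10 12 ![3, 2, 1, 0, 4, 5, 6] (by decide) h0 (by decide) (by decide +kernel)
        (by decide +kernel) rfl
  by_cases h : l < 13
  · exact h1 l h
  have : l = 13 ∨ l = 14 ∨ l = 15 := by omega
  rcases this with rfl | rfl | rfl
  · exact key 13 13 ![5, 6, 12, 3, 11, 9, 8] (by decide) h1 (by decide) (by decide +kernel)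
      (by decide +kernel) rfl
  · exact key 13 14 ![8, 9, 10, 6, 12, 3, 2] (by decide) h1 (by decide) (by decide +kernel)
      (by decide +kernel) rfl
  · exact key 13 15 ![2, 3, 11, 9, 10, 6, 5] (by decide) h1 (by decide) (by decide +kernel)
      (by decide +kernel) rfl

variable {s} (hcox : SatisfiesCoxeter y333 s)
include hcox

theorem rootElt_namedElt {l : ℕ} (hl : l < 16) :
    RootElt s (ofCoords (rootCoords l)) (namedElt s l) :=
  (isRoot_namedElt s hl).rootElt hcox

theorem namedElt_mul_self {l : ℕ} (hl : l < 16) : namedElt s l * namedElt s l = 1 :=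
  (rootElt_namedElt hcox hl).mul_self hcox

theorem namedElt_sq {l m : ℕ} (hl : l < 16) (hm : m < 16)
    (h : (orthMask l).testBit m = true) : (namedElt s l * namedElt s m) ^ 2 = 1 :=
  (rootElt_namedElt hcox hl).sq_of_ip_eq_zero hcox (rootElt_namedElt hcox hm) <| by
    rw [ip_ofCoords (length_rootCoords l hl) (length_rootCoords m hm), orthMask_spec l hl m hm h]

theorem namedElt_cube {l m : ℕ} (hl : l < 16) (hm : m < 16)
    (h : (joinMask l).testBit m = true) : (namedElt s l * namedElt s m) ^ 3 = 1 :=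
  (rootElt_namedElt hcox hl).cube_of_ip hcox (rootElt_namedElt hcox hm) <| by
    rw [ip_ofCoords (length_rootCoords l hl) (length_rootCoords m hm)]
    exact joinMask_spec l hl m hm h

end Group

/-! ### Collapse -/

/-- One step of the propagation of equalities between the elements of named roots: if the elements
of the roots in the mask `m` are equal, and the `w`-th root is orthogonal to one of them and joined
to another, then its element is the same. -/
def collapseAt (m w : ℕ) : ℕ :=
  bif (m &&& orthMask w) != 0 && (m &&& joinMask w) != 0 then m ||| 1 <<< w else m

/-- Repeated propagation of equalities. -/
def collapse (m : ℕ) : ℕ :=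
  (List.range 16 ++ List.range 16 ++ List.range 16).foldl collapseAt m

/-- The mask `1023` selects the ten generators. The bound `i < 13` leaves out the pairs of two `zₖ`,
whose identification causes no total collapse. Three sweeps over the sixteen roots are enough for
all other pairs. -/
theorem collapse_eq : ∀ i < 13, ∀ j < 16, i ≠ j →
    collapse (1 <<< i ||| 1 <<< j) &&& 1023 = 1023 := by
  decide +kernel

theorem exists_testBit_of_ne_zero {a b : ℕ} (h : (a &&& b != 0) = true) :
    ∃ i, a.testBit i = true ∧ b.testBit i = true := by
  obtain ⟨i, hi⟩ := Nat.exists_testBit_of_ne_zero (bne_iff_ne.1 h)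
  rw [Nat.testBit_and, Bool.and_eq_true] at hi
  exact ⟨i, hi⟩

theorem testBit_or_one_shiftLeft {m w i : ℕ} :
    (m ||| 1 <<< w).testBit i = true ↔ m.testBit i = true ∨ i = w := by
  rw [Nat.testBit_or, Bool.or_eq_true, Nat.one_shiftLeft, Nat.testBit_two_pow, decide_eq_true_iff,
    eq_comm (a := w)]

section Group

variable {G : Type*} [Group G] {s : Node → G} (hcox : SatisfiesCoxeter y333 s)
include hcox

theorem collapseAt_sound {e : G} {m : ℕ} (hm : ∀ i, m.testBit i = true → i < 16 ∧ namedElt s i = e)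
    {w : ℕ} (hw : w < 16) (i : ℕ) (hi : (collapseAt m w).testBit i = true) :
    i < 16 ∧ namedElt s i = e := by
  unfold collapseAt at hi
  cases hc : (m &&& orthMask w) != 0 && (m &&& joinMask w) != 0 with
  | false => rw [hc] at hi; exact hm i hi
  | true =>
    rw [hc, cond_true, testBit_or_one_shiftLeft] at hi
    rcases hi with hi | rfl
    · exact hm i hi
    rw [Bool.and_eq_true] at hc
    obtain ⟨j, hj1, hj2⟩ := exists_testBit_of_ne_zero hc.1
    obtain ⟨k, hk1, hk2⟩ := exists_testBit_of_ne_zero hc.2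
    have h2 := namedElt_sq hcox hw (hm j hj1).1 hj2
    have h3 := namedElt_cube hcox hw (hm k hk1).1 hk2
    have he := namedElt_mul_self hcox (hm j hj1).1
    rw [(hm j hj1).2] at h2 he
    rw [(hm k hk1).2] at h3
    exact ⟨hw, eq_of_sq_of_cube he h2 h3⟩

theorem collapse_sound {e : G} {m : ℕ} (hm : ∀ i, m.testBit i = true → i < 16 ∧ namedElt s i = e)
    (i : ℕ) (hi : (collapse m).testBit i = true) : namedElt s i = e := by
  have key : ∀ (l : List ℕ) (m : ℕ), (∀ w ∈ l, w < 16) →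
      (∀ i, m.testBit i = true → i < 16 ∧ namedElt s i = e) →
      ∀ i, (l.foldl collapseAt m).testBit i = true → i < 16 ∧ namedElt s i = e := by
    intro l
    induction l with
    | nil => intro m _ hm; exact hm
    | cons w l ih =>
      intro m hl hm
      exact ih _ (fun x hx => hl x (List.mem_cons_of_mem _ hx))
        (collapseAt_sound hcox hm (hl w List.mem_cons_self))
  exact (key _ m (by decide) hm i hi).2

/-- An equality would make all generators one involution or the identity, so `G` would have at most
two elements. -/
theorem namedElt_ne (hG : 2 < ENat.card G) (hgen : Subgroup.closure (Set.range s) = ⊤)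
    {i j : ℕ} (hi : i < 13) (hj : j < 16) (hij : i ≠ j) : namedElt s i ≠ namedElt s j := by
  intro he
  have hall : ∀ k < 10, namedElt s k = namedElt s i := by
    intro k hk
    refine collapse_sound hcox (m := 1 <<< i ||| 1 <<< j) ?_ k ?_
    · intro l hl
      rw [testBit_or_one_shiftLeft, Nat.one_shiftLeft, Nat.testBit_two_pow,
        decide_eq_true_iff] at hl
      rcases hl with rfl | rfl
      · exact ⟨by omega, rfl⟩
      · exact ⟨hj, he.symm⟩
    · have h1 : Nat.testBit 1023 k = true := by interval_cases k <;> rfl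
      rw [← collapse_eq i hi j hj hij, Nat.testBit_and, Bool.and_eq_true] at h1
      exact h1.1
  have hs : ∀ n, s n = namedElt s i := by
    rintro (_ | ⟨a, b⟩)
    · exact hall 0 (by norm_num)
    · fin_cases a <;> fin_cases b
      · exact hall 1 (by norm_num)
      · exact hall 2 (by norm_num)
      · exact hall 3 (by norm_num)
      · exact hall 4 (by norm_num)
      · exact hall 5 (by norm_num)
      · exact hall 6 (by norm_num)
      · exact hall 7 (by norm_num)
      · exact hall 8 (by norm_num)
      · exact hall 9 (by norm_num)
  have hm := namedElt_mul_self hcox (show i < 16 by omega)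
  have huniv : ∀ g : G, g = 1 ∨ g = namedElt s i := by
    intro g
    have hg : g ∈ Subgroup.closure (Set.range s) := by rw [hgen]; trivial
    induction hg using Subgroup.closure_induction with
    | mem x hx => obtain ⟨n, rfl⟩ := hx; exact Or.inr (hs n)
    | one => exact Or.inl rfl
    | mul x y _ _ hx hy =>
      rcases hx with rfl | rfl <;> rcases hy with rfl | rfl <;> simp [hm]
    | inv x _ hx =>
      rcases hx with rfl | rfl
      · simp
      · exact Or.inr (inv_eq_of_mul_eq_one_left hm)
  have hle : ENat.card G ≤ 2 := by
    rw [← Set.encard_univ]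
    calc (Set.univ : Set G).encard ≤ ({1, namedElt s i} : Set G).encard :=
          Set.encard_le_encard fun g _ => huniv g
      _ ≤ ({namedElt s i} : Set G).encard + 1 := Set.encard_insert_le _ _
      _ = 2 := by rw [Set.encard_singleton]; norm_num
  exact absurd hG (not_lt.2 hle)

end Group

/-! ### The fourteen nodes -/

/-- The Fano plane labels of the nodes `a, b₀, c₀, d₀, b₁, c₁, d₁, b₂, c₂, d₂, a₀, a₁, a₂, z`. -/
def fanoLabel : Fin 14 → FanoPt ⊕ FanoPt :=
  -- The nodes `a`, `cᵢ`, `aₖ` are the points; `bᵢ`, `dᵢ`, `z` are the lines.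
  ![.inl ⟨![0, 0, 1], by decide⟩, .inr ⟨![1, 0, 0], by decide⟩, .inl ⟨![0, 1, 0], by decide⟩,
    .inr ⟨![1, 0, 1], by decide⟩, .inr ⟨![0, 1, 0], by decide⟩, .inl ⟨![1, 0, 0], by decide⟩,
    .inr ⟨![0, 1, 1], by decide⟩, .inr ⟨![1, 1, 0], by decide⟩, .inl ⟨![1, 1, 0], by decide⟩,
    .inr ⟨![1, 1, 1], by decide⟩, .inl ⟨![0, 1, 1], by decide⟩, .inl ⟨![1, 0, 1], by decide⟩,
    .inl ⟨![1, 1, 1], by decide⟩, .inr ⟨![0, 0, 1], by decide⟩]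

theorem fanoLabel_bijective : Function.Bijective fanoLabel := by
  rw [Fintype.bijective_iff_injective_and_card]
  constructor
  · decide +kernel
  · decide +kernel

/-- Incidence as a decidable relation. -/
def incident : FanoPt ⊕ FanoPt → FanoPt ⊕ FanoPt → Bool
  | .inl p, .inr l => dotProduct l.1 p.1 = 0
  | .inr l, .inl p => dotProduct l.1 p.1 = 0
  | _, _ => false

theorem fanoIncidence_adj (x y : FanoPt ⊕ FanoPt) :
    fanoIncidence.Adj x y ↔ incident x y = true := by
  rw [fanoIncidence, SimpleGraph.fromRel_adj]
  constructor
  · rintro ⟨-, ⟨p, l, rfl, rfl, h⟩ | ⟨p, l, rfl, rfl, h⟩⟩ <;> exact decide_eq_true h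
  · intro h
    match x, y, h with
    | .inl p, .inr l, h => exact ⟨Sum.inl_ne_inr, Or.inl ⟨p, l, rfl, rfl, of_decide_eq_true h⟩⟩
    | .inr l, .inl p, h => exact ⟨Sum.inr_ne_inl, Or.inr ⟨p, l, rfl, rfl, of_decide_eq_true h⟩⟩

theorem incident_fanoLabel : ∀ i j : Fin 14,
    incident (fanoLabel i) (fanoLabel j) = (joinMask i).testBit j := by
  decide +kernel

/-- The one pair that is neither joined nor orthogonal is `a₀, z₀`, with inner product 2. Since `z₁`
is orthogonal to `a₀`, the relation for this pair comes from `z₀ = z₁`. -/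
theorem orth_of_not_join : ∀ i < 14, ∀ j < 14, i ≠ j → (joinMask i).testBit j = false →
    ((orthMask i).testBit j || (i == 13 && (orthMask 14).testBit j) ||
      (j == 13 && (orthMask i).testBit 14)) = true := by
  decide +kernel

/-! ### Exactly fourteen nodes, and their graph -/

section Group

variable {G : Type*} [Group G] {s : Node → G} (hG : 2 < ENat.card G)
  (hgen : Subgroup.closure (Set.range s) = ⊤) (hcox : SatisfiesCoxeter y333 s)
include hG hgen hcox

theorem namedElt_injOn {i j : ℕ} (hi : i < 14) (hj : j < 14) (h : namedElt s i = namedElt s j) :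
    i = j := by
  by_contra hij
  by_cases hi' : i < 13
  · exact namedElt_ne hcox hG hgen hi' (by omega) hij h
  · exact namedElt_ne hcox hG hgen (i := j) (j := i) (by omega) (by omega) (Ne.symm hij) h.symm

variable (h14 : (closureNodes s).encard ≤ 14)
include h14

theorem namedElt_eq_of_closureNodes_le {i j : ℕ} (hi : 13 ≤ i) (hi' : i < 16) (hj : 13 ≤ j)
    (hj' : j < 16) : namedElt s i = namedElt s j := by
  by_contra hne
  -- If two of the `zₖ` differed, putting them in places 13 and 14 after the thirteen other named
  -- elements would list fifteen different nodes.
  let f : ℕ → G := fun k => if k = 13 then namedElt s i else if k = 14 then namedElt s j else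
    namedElt s k
  have hinj : Set.InjOn f (Finset.range 15) := by
    have key : ∀ k l : ℕ, k < l → l < 15 → f k ≠ f l := by
      intro k l hkl hl
      simp only [f]
      by_cases hl' : l = 14
      · subst hl'
        by_cases hk : k = 13
        · simpa [hk] using hne
        · simpa [hk, hkl.ne] using namedElt_ne hcox hG hgen (i := k) (j := j) (by omega) hj'
            (by omega)
      · by_cases hl2 : l = 13
        · subst hl2
          simpa [hkl.ne, show k ≠ 14 by omega] using
            namedElt_ne hcox hG hgen (i := k) (j := i) (by omega) hi' (by omega)
        · simpa [hl', hl2, show k ≠ 13 by omega, show k ≠ 14 by omega] using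
            namedElt_ne hcox hG hgen (i := k) (j := l) (by omega) (by omega) (by omega)
    intro k hk l hl hkl
    rw [Finset.mem_coe, Finset.mem_range] at hk hl
    rcases lt_trichotomy k l with h | h | h
    · exact absurd hkl (key k l h hl)
    · exact h
    · exact absurd hkl.symm (key l k h hk)
  have hsub : Set.image f (Finset.range 15) ⊆ closureNodes s := by
    rintro _ ⟨k, hk, rfl⟩
    rw [Finset.mem_coe, Finset.mem_range] at hk
    simp only [f]
    split_ifs
    · exact ⟨_, isRoot_namedElt s hi'⟩
    · exact ⟨_, isRoot_namedElt s hj'⟩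
    · exact ⟨_, isRoot_namedElt s (by omega)⟩
  have h1 := (Set.encard_le_encard hsub).trans h14
  rw [hinj.encard_image, Set.encard_coe_eq_coe_finsetCard, Finset.card_range] at h1
  exact absurd h1 (by decide)

/-- No further `a₇` chains need to be examined: fourteen distinct nodes exhaust a set of at most
fourteen. -/
theorem closureNodes_eq :
    closureNodes s = Set.image (namedElt s) (Finset.range 14) ∧ (closureNodes s).encard = 14 := by
  have hinj : Set.InjOn (namedElt s) (Finset.range 14) := by
    intro k hk l hl hkl
    rw [Finset.mem_coe, Finset.mem_range] at hk hl
    exact namedElt_injOn hG hgen hcox hk hl hkl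
  have hsub : Set.image (namedElt s) (Finset.range 14) ⊆ closureNodes s := by
    rintro _ ⟨k, hk, rfl⟩
    rw [Finset.mem_coe, Finset.mem_range] at hk
    exact ⟨_, isRoot_namedElt s (by omega)⟩
  have hcard : (Set.image (namedElt s) (Finset.range 14)).encard = 14 := by
    rw [hinj.encard_image, Set.encard_coe_eq_coe_finsetCard, Finset.card_range]; rfl
  have hfin : (closureNodes s).Finite :=
    Set.finite_of_encard_le_coe (k := 14) h14
  have heq : Set.image (namedElt s) (Finset.range 14) = closureNodes s :=
    hfin.eq_of_subset_of_encard_le' hsub (by rw [hcard]; exact h14)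
  exact ⟨heq.symm, by rw [← heq, hcard]⟩

theorem namedElt_sq_of_not_join {i j : ℕ} (hi : i < 14) (hj : j < 14) (hij : i ≠ j)
    (h : (joinMask i).testBit j = false) : (namedElt s i * namedElt s j) ^ 2 = 1 := by
  have h1314 : namedElt s 13 = namedElt s 14 := namedElt_eq_of_closureNodes_le hG hgen hcox h14
    (by decide) (by decide) (by decide) (by decide)
  have ho := orth_of_not_join i hi j hj hij h
  simp only [Bool.or_eq_true, Bool.and_eq_true, beq_iff_eq] at ho
  clear h
  rcases ho with (h | ⟨rfl, h⟩) | ⟨rfl, h⟩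
  · exact namedElt_sq hcox (by omega) (by omega) h
  · rw [h1314]; exact namedElt_sq hcox (by omega) (by omega) h
  · rw [h1314]; exact namedElt_sq hcox (by omega) (by omega) h

/-- The fourteen nodes of the closure. -/
noncomputable def nodeEquiv : Fin 14 ≃ closureNodes s :=
  Equiv.ofBijective (fun i => ⟨namedElt s i, _, isRoot_namedElt s (by omega)⟩) <| by
    constructor
    · intro i j hij
      exact Fin.ext (namedElt_injOn hG hgen hcox i.2 j.2 (congrArg Subtype.val hij))
    · rintro ⟨g, hg⟩
      have hg' := hg
      rw [(closureNodes_eq hG hgen hcox h14).1] at hg'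
      obtain ⟨k, hk, rfl⟩ := hg'
      rw [Finset.mem_coe, Finset.mem_range] at hk
      exact ⟨⟨k, hk⟩, rfl⟩

theorem closureGraph_adj (i j : Fin 14) :
    (closureGraph s).Adj (nodeEquiv hG hgen hcox h14 i) (nodeEquiv hG hgen hcox h14 j) ↔
      (joinMask i).testBit j = true := by
  -- A node may be represented by roots other than the named one. If such roots were joined although
  -- the named ones are not, the two elements would satisfy both relations and be equal.
  have key : ∀ i j : Fin 14, i ≠ j → (∃ v w, IsRoot s v (namedElt s i) ∧
      IsRoot s w (namedElt s j) ∧ (ip v w = 1 ∨ ip v w = -1)) →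
      (joinMask i).testBit j = true := by
    rintro i j hij ⟨v, w, hv, hw, h⟩
    by_contra hjoin
    rw [Bool.not_eq_true] at hjoin
    have hij' : (i : ℕ) ≠ j := fun h => hij (Fin.ext h)
    have h3 := (hv.rootElt hcox).cube_of_ip hcox (hw.rootElt hcox) h
    have h2 := namedElt_sq_of_not_join hG hgen hcox h14 i.2 j.2 hij' hjoin
    exact hij' (namedElt_injOn hG hgen hcox i.2 j.2
      (eq_of_sq_of_cube ((hw.rootElt hcox).mul_self hcox) h2 h3))
  have hsymm : ∀ i j : Fin 14, (joinMask i).testBit j = true → i ≠ j ∧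
      (joinMask j).testBit i = true := by decide +kernel
  rw [closureGraph, SimpleGraph.fromRel_adj]
  constructor
  · rintro ⟨hne, h | h⟩
    · exact key i j (fun h => hne (by rw [h])) h
    · exact (hsymm _ _ (key j i (fun h => hne (by rw [h])) h)).2
  · intro h
    refine ⟨fun he => (hsymm i j h).1 ((nodeEquiv hG hgen hcox h14).injective he), Or.inl
      ⟨_, _, isRoot_namedElt s (by omega), isRoot_namedElt s (by omega), ?_⟩⟩
    rw [ip_ofCoords (length_rootCoords _ (by omega)) (length_rootCoords _ (by omega))]
    exact joinMask_spec _ (by omega) _ (by omega) h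

theorem nonempty_closureGraph_iso : Nonempty (closureGraph s ≃g fanoIncidence) := by
  refine ⟨⟨(nodeEquiv hG hgen hcox h14).symm.trans (Equiv.ofBijective _ fanoLabel_bijective), ?_⟩⟩
  intro x y
  obtain ⟨i, rfl⟩ := (nodeEquiv hG hgen hcox h14).surjective x
  obtain ⟨j, rfl⟩ := (nodeEquiv hG hgen hcox h14).surjective y
  rw [closureGraph_adj hG hgen hcox h14, fanoIncidence_adj]
  simp only [Equiv.trans_apply, Equiv.symm_apply_apply, Equiv.ofBijective_apply]
  rw [incident_fanoLabel]

theorem satisfiesCoxeter_closureGraph :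
    SatisfiesCoxeter (closureGraph s) (fun x => (x : G)) := by
  refine ⟨fun x => ?_, fun x y h => ?_, fun x y hne h => ?_⟩
  · obtain ⟨v, hv⟩ := x.2
    rw [pow_two]
    exact (hv.rootElt hcox).mul_self hcox
  · obtain ⟨i, rfl⟩ := (nodeEquiv hG hgen hcox h14).surjective x
    obtain ⟨j, rfl⟩ := (nodeEquiv hG hgen hcox h14).surjective y
    rw [closureGraph_adj hG hgen hcox h14] at h
    exact namedElt_cube hcox (by omega) (by omega) h
  · obtain ⟨i, rfl⟩ := (nodeEquiv hG hgen hcox h14).surjective x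
    obtain ⟨j, rfl⟩ := (nodeEquiv hG hgen hcox h14).surjective y
    rw [closureGraph_adj hG hgen hcox h14, Bool.not_eq_true] at h
    exact namedElt_sq_of_not_join hG hgen hcox h14 i.2 j.2
      (fun h => hne (by rw [Fin.ext h])) h

end Group

/-! ### Coset enumeration -/

theorem foldl_preserves {α β : Type*} {Q : β → Prop} {f : β → α → β} (l : List α)
    (hf : ∀ b, ∀ a ∈ l, Q b → Q (f b a)) {b : β} (hb : Q b) : Q (l.foldl f b) := by
  induction l generalizing b with
  | nil => exact hb
  | cons a l ih =>
    exact ih (fun b a ha => hf b a (List.mem_cons_of_mem _ ha)) (hf b a List.mem_cons_self hb)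

/-- The state of a coset enumeration whose cosets are labelled by natural numbers: the set of the
labels in use, and the set of the known edges, the edge of the generator `g < 16` at the label `x`
being encoded as `16 * x + g`. Both sets are bit masks. -/
structure CosetState where
  seen : ℕ
  known : ℕ

/-- Apply a function to a natural number in such a way that the number is evaluated first. -/
def forced {α : Type*} (n : ℕ) (k : ℕ → α) : α :=
  match n with
  | 0 => k 0
  | m + 1 => k (m + 1)

theorem forced_eq {α : Type*} (n : ℕ) (k : ℕ → α) : forced n k = k n := by
  cases n <;> rfl

namespace CosetState

/-- Fold over a list, evaluating the state after each step. -/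
def run (f : CosetState → ℕ → CosetState) : List ℕ → CosetState → CosetState
  | [], st => st
  | t :: l, st => forced (f st t).seen fun a => forced (f st t).known fun b => run f l ⟨a, b⟩

theorem run_eq (f : CosetState → ℕ → CosetState) (l : List ℕ) (st : CosetState) :
    run f l st = l.foldl f st := by
  induction l generalizing st with
  | nil => rfl
  | cons t l ih => rw [run, forced_eq, forced_eq, ih, List.foldl_cons]

variable (act : ℕ → ℕ → ℕ)

/-- Whether the edge of `g` at `x` is known. -/
def look (st : CosetState) (g x : ℕ) : Bool :=
  Nat.blt g 16 && st.known.testBit (16 * x + g)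

/-- Add the edge of `g` between `x` and `y`. -/
def addEdge (st : CosetState) (g x y : ℕ) : CosetState :=
  ⟨st.seen, st.known ||| 1 <<< (16 * x + g) ||| 1 <<< (16 * y + g)⟩

/-- Introduce a new label by an edge of `g` at `x`. -/
def define (J : List ℕ) (st : CosetState) (g x : ℕ) : CosetState :=
  bif J.contains g && Nat.blt g 16 && st.seen.testBit x && !st.seen.testBit (act g x) &&
    Nat.beq (act g (act g x)) x then
    addEdge ⟨st.seen ||| 1 <<< act g x, st.known⟩ g x (act g x)
  else st

/-- Follow known edges. -/
def walk (st : CosetState) : List ℕ → ℕ → Option ℕ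
  | [], x => some x
  | g :: w, x => bif st.look g x then walk st w (act g x) else none

/-- Deduce an edge from a relator `g :: w` all of whose other edges at `x` are known. -/
def deduce (st : CosetState) (r : List ℕ) (x : ℕ) : CosetState :=
  match r with
  | [] => st
  | g :: w =>
    match st.walk act w x with
    | none => st
    | some y =>
      bif Nat.blt g 16 && st.seen.testBit x && Nat.beq y (act g x) && Nat.beq (act g y) x then
        st.addEdge g x y
      else st

/-- Start with one label, fixed by the generators in `J`. -/
def start (J : List ℕ) (p : ℕ) : CosetState :=
  J.foldl (fun st g => bif Nat.blt g 16 && Nat.beq (act g p) p then st.addEdge g p p else st)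
    ⟨1 <<< p, 0⟩

/-- Whether the labels in use are below `256` and all edges of the generators in `J` are known. -/
def complete (J : List ℕ) (st : CosetState) : Bool :=
  Nat.blt st.seen (1 <<< 256) &&
    (List.range 256).all fun x => !st.seen.testBit x || J.all fun g => st.look g x

/-! ### Enumerated edges are true equations between cosets -/

section Sound

variable {P : Type*} [Group P] {H : Subgroup P} {S : ℕ → P}

/-- The correctness of a state, for a labelling `C` of cosets. -/
structure Sound (H : Subgroup P) (S : ℕ → P) (p : ℕ) (st : CosetState) (C : ℕ → P ⧸ H) :
    Prop where
  base : C p = ((1 : P) : P ⧸ H)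
  seen_base : st.seen.testBit p = true
  edge : ∀ g x, g < 16 → st.known.testBit (16 * x + g) = true → st.seen.testBit x = true ∧
    st.seen.testBit (act g x) = true ∧ S g • C x = C (act g x)

variable {act}

theorem key_eq_iff {g g' x x' : ℕ} (hg : g < 16) (hg' : g' < 16) :
    16 * x + g = 16 * x' + g' ↔ x = x' ∧ g = g' := by omega

theorem Sound.addEdge {p : ℕ} {st : CosetState} {C : ℕ → P ⧸ H} (h : Sound act H S p st C)
    {g x y : ℕ} (hg : g < 16) (hS : S g * S g = 1) (hx : st.seen.testBit x = true)
    (hy : st.seen.testBit y = true) (hxy : act g x = y) (hyx : act g y = x)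
    (he : S g • C x = C y) : Sound act H S p (st.addEdge g x y) C := by
  refine ⟨h.base, h.seen_base, fun g' x' hg' hk => ?_⟩
  simp only [CosetState.addEdge, testBit_or_one_shiftLeft, key_eq_iff hg' hg] at hk
  rcases hk with (hk | ⟨rfl, rfl⟩) | ⟨rfl, rfl⟩
  · exact h.edge g' x' hg' hk
  · exact ⟨hx, by rw [hxy]; exact hy, by rw [he, hxy]⟩
  · refine ⟨hy, by rw [hyx]; exact hx, ?_⟩
    rw [hyx, ← he, smul_smul, hS, one_smul]

theorem Sound.look {p : ℕ} {st : CosetState} {C : ℕ → P ⧸ H} (h : Sound act H S p st C)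
    {g x : ℕ} (hl : st.look g x = true) : g < 16 ∧ st.seen.testBit x = true ∧
      st.seen.testBit (act g x) = true ∧ S g • C x = C (act g x) := by
  simp only [CosetState.look, Bool.and_eq_true, Nat.blt_eq] at hl
  exact ⟨hl.1, h.edge g x hl.1 hl.2⟩

theorem Sound.walk {p : ℕ} {st : CosetState} {C : ℕ → P ⧸ H} (h : Sound act H S p st C)
    {w : List ℕ} {x y : ℕ} (hw : st.walk act w x = some y) (hx : st.seen.testBit x = true) :
    st.seen.testBit y = true ∧ (w.map S).reverse.prod • C x = C y := by
  induction w generalizing x with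
  | nil =>
    simp only [CosetState.walk, Option.some.injEq] at hw
    subst hw
    exact ⟨hx, by simp⟩
  | cons g w ih =>
    rw [CosetState.walk] at hw
    cases hl : st.look g x with
    | false => rw [hl] at hw; simp at hw
    | true =>
      rw [hl, cond_true] at hw
      obtain ⟨-, -, h2, h3⟩ := h.look hl
      have := ih hw h2
      refine ⟨this.1, ?_⟩
      rw [List.map_cons, List.reverse_cons, List.prod_append, List.prod_singleton, mul_smul, h3,
        this.2]

/-- As the generators are involutions, the relator makes `S g` the product of the remaining letters
in reverse order, which is how the walk along `w` acts on cosets. The endpoint of the walk is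
therefore the coset to which `g` leads. -/
theorem Sound.deduce {p : ℕ} {st : CosetState} {C : ℕ → P ⧸ H} (h : Sound act H S p st C)
    (hS : ∀ g < 16, S g * S g = 1) {r : List ℕ} (hr : (r.map S).prod = 1) (hr' : ∀ g ∈ r, g < 16)
    (x : ℕ) : Sound act H S p (st.deduce act r x) C := by
  unfold CosetState.deduce
  match r with
  | [] => exact h
  | g :: w =>
    dsimp only
    cases hw : st.walk act w x with
    | none => exact h
    | some y =>
      dsimp only
      cases hc : Nat.blt g 16 && st.seen.testBit x && Nat.beq y (act g x) &&
          Nat.beq (act g y) x with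
      | false => exact h
      | true =>
        simp only [Bool.and_eq_true, Nat.blt_eq, Nat.beq_eq] at hc
        obtain ⟨⟨⟨hg, hx⟩, hy⟩, hyx⟩ := hc
        have h1 := h.walk hw hx
        refine h.addEdge hg (hS g hg) hx h1.1 hy.symm hyx ?_
        have h2 : S g = (w.map S).reverse.prod := by
          rw [List.map_cons, List.prod_cons] at hr
          rw [eq_inv_of_mul_eq_one_left hr, List.prod_inv_reverse]
          congr 2
          rw [List.map_map]
          refine List.map_congr_left fun a ha => ?_
          exact inv_eq_of_mul_eq_one_left (hS a (hr' a (List.mem_cons_of_mem _ ha)))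
        rw [h2, h1.2]

/-- An unused label is under no constraint yet, so `C` can be redefined there as the coset that the
new edge requires. -/
theorem Sound.define {p : ℕ} {st : CosetState} {C : ℕ → P ⧸ H} (h : Sound act H S p st C)
    (hS : ∀ g < 16, S g * S g = 1) (J : List ℕ) (g x : ℕ) :
    ∃ C', Sound act H S p (st.define act J g x) C' := by
  unfold CosetState.define
  cases hc : J.contains g && Nat.blt g 16 && st.seen.testBit x && !st.seen.testBit (act g x) &&
    Nat.beq (act g (act g x)) x with
  | false => exact ⟨C, h⟩
  | true =>
    simp only [Bool.and_eq_true, Nat.blt_eq, Nat.beq_eq, Bool.not_eq_true'] at hc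
    obtain ⟨⟨⟨⟨-, hg⟩, hx⟩, hy⟩, hyx⟩ := hc
    have hne : ∀ z, st.seen.testBit z = true → z ≠ act g x := by
      rintro z hz rfl
      rw [hy] at hz
      exact Bool.noConfusion hz
    let C' : ℕ → P ⧸ H := Function.update C (act g x) (S g • C x)
    have hC' : ∀ z, st.seen.testBit z = true → C' z = C z := fun z hz =>
      Function.update_of_ne (hne z hz) _ _
    have hs : Sound act H S p ⟨st.seen ||| 1 <<< act g x, st.known⟩ C' := by
      refine ⟨by rw [hC' p h.seen_base, h.base], testBit_or_one_shiftLeft.2 (.inl h.seen_base), ?_⟩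
      intro g' x' hg' hk
      obtain ⟨h1, h2, h3⟩ := h.edge g' x' hg' hk
      exact ⟨testBit_or_one_shiftLeft.2 (.inl h1), testBit_or_one_shiftLeft.2 (.inl h2),
        by rw [hC' _ h1, hC' _ h2, h3]⟩
    refine ⟨C', hs.addEdge hg (hS g hg) (testBit_or_one_shiftLeft.2 (.inl hx))
      (testBit_or_one_shiftLeft.2 (.inr rfl)) rfl hyx ?_⟩
    rw [hC' x hx]
    exact (Function.update_self (act g x) (S g • C x) C).symm

theorem sound_start (hS : ∀ g < 16, S g * S g = 1) (J : List ℕ) (hJ : ∀ g ∈ J, S g ∈ H) (p : ℕ) :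
    Sound act H S p (start act J p) fun _ => ((1 : P) : P ⧸ H) := by
  unfold start
  refine foldl_preserves (Q := fun st => Sound act H S p st fun _ => ((1 : P) : P ⧸ H)) J ?_
    ⟨rfl, by simp [Nat.one_shiftLeft], fun g x _ h => by simp at h⟩
  intro st g hg h
  cases hc : Nat.blt g 16 && Nat.beq (act g p) p with
  | false => exact h
  | true =>
    simp only [Bool.and_eq_true, Nat.blt_eq, Nat.beq_eq] at hc
    refine h.addEdge hc.1 (hS g hc.1) h.seen_base h.seen_base hc.2 hc.2 ?_
    rw [MulAction.Quotient.smul_coe, smul_eq_mul, mul_one]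
    exact (QuotientGroup.eq.2 (by simpa using hJ g hg)).symm

end Sound

variable {act}

theorem seen_start (J : List ℕ) (p : ℕ) : (start act J p).seen = 1 <<< p := by
  unfold start
  refine foldl_preserves (Q := fun st : CosetState => st.seen = 1 <<< p) J ?_ rfl
  intro st g _ h
  cases Nat.blt g 16 && Nat.beq (act g p) p with
  | false => exact h
  | true => exact h

end CosetState

/-- The data of a coset enumeration: the base point, the generators of the subgroup, the
definitions `16 * x + g`, and the deductions `256 * r + x`, where `r` refers to a list of
relators. -/
structure Enumeration where
  base : ℕ
  sub : List ℕ
  tree : List ℕ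
  deductions : List ℕ

namespace Enumeration

open CosetState

variable (act : ℕ → ℕ → ℕ) (rel : List (List ℕ)) (J : List ℕ) (E : Enumeration)

/-- The state after the definitions. -/
def afterTree : CosetState :=
  run (fun st t => st.define act J (t % 16) (t / 16)) E.tree (start act E.sub E.base)

/-- The final state. -/
def final : CosetState :=
  run (fun st t => st.deduce act (rel.getD (t / 256) []) (t % 256)) E.deductions
    (E.afterTree act J)

/-- Whether the enumeration is finished. -/
def check : Bool := complete J (E.final act rel J)

/-! ### What a finished enumeration implies -/

section

variable {act rel J E} {P : Type*} [Group P] {S : ℕ → P}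

theorem exists_sound (hS : ∀ g < 16, S g * S g = 1)
    (hrel : ∀ r ∈ rel, (r.map S).prod = 1 ∧ ∀ g ∈ r, g < 16) :
    ∃ C, Sound act (Subgroup.closure (Set.image S {g | g ∈ E.sub})) S E.base
      (E.final act rel J) C := by
  set H := Subgroup.closure (Set.image S {g | g ∈ E.sub})
  rw [final, afterTree, run_eq, run_eq]
  refine foldl_preserves (Q := fun st => ∃ C, Sound act H S E.base st C) E.deductions ?_ ?_
  · rintro st t - ⟨C, h⟩
    refine ⟨C, ?_⟩
    by_cases ht : t / 256 < rel.length
    · have hm : rel.getD (t / 256) [] ∈ rel := by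
        rw [List.getD_eq_getElem _ _ ht]; exact List.getElem_mem _
      exact h.deduce hS (hrel _ hm).1 (hrel _ hm).2 _
    · rw [List.getD_eq_default _ _ (not_lt.1 ht)]
      exact h
  · refine foldl_preserves (Q := fun st => ∃ C, Sound act H S E.base st C) E.tree ?_ ?_
    · rintro st t - ⟨C, h⟩
      exact h.define hS J _ _
    · have hsub : ∀ g ∈ E.sub, S g ∈ H := fun g hg => Subgroup.subset_closure ⟨g, hg, rfl⟩
      exact ⟨fun _ => ((1 : P) : P ⧸ H), sound_start hS _ hsub _⟩

theorem lt_of_seen (hE : E.check act rel J = true) {x : ℕ}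
    (hx : (E.final act rel J).seen.testBit x = true) : x < 256 := by
  simp only [check, complete, Bool.and_eq_true, Nat.blt_eq, Nat.one_shiftLeft] at hE
  by_contra h
  have h2 : 2 ^ 256 ≤ 2 ^ x := Nat.pow_le_pow_right (by norm_num) (not_lt.1 h)
  rw [Nat.testBit_lt_two_pow (hE.1.trans_le h2)] at hx
  exact Bool.noConfusion hx

theorem look_of_seen (hE : E.check act rel J = true) {x : ℕ}
    (hx : (E.final act rel J).seen.testBit x = true) {g : ℕ} (hg : g ∈ J) :
    (E.final act rel J).look g x = true := by
  have hlt := lt_of_seen hE hx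
  simp only [check, complete, Bool.and_eq_true, List.all_eq_true, List.mem_range] at hE
  have := hE.2 x hlt
  rw [hx, Bool.not_true, Bool.false_or, List.all_eq_true] at this
  exact this g hg

/-- If the labels correspond injectively to the points of an action of `P`, then an element
generated by `J` that fixes the base point lies in the subgroup. -/
theorem mem_of_fixes {V : Type*} [MulAction P V] {dec : ℕ → V} (hS : ∀ g < 16, S g * S g = 1)
    (hrel : ∀ r ∈ rel, (r.map S).prod = 1 ∧ ∀ g ∈ r, g < 16)
    (hdec : ∀ x < 256, ∀ y < 256, dec x = dec y → x = y)
    (hact : ∀ g < 16, ∀ x, S g • dec x = dec (act g x))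
    (hE : E.check act rel J = true) {h : P} (hh : h ∈ Subgroup.closure (Set.image S {g | g ∈ J}))
    (hfix : h • dec E.base = dec E.base) : h ∈ Subgroup.closure (Set.image S {g | g ∈ E.sub}) := by
  obtain ⟨C, hC⟩ := exists_sound (act := act) (rel := rel) (J := J) (E := E) hS hrel
  set st := E.final act rel J with hst
  -- A word for `h` can be followed along known edges, moving the vector and the coset in parallel.
  have key : ∀ x, st.seen.testBit x = true → ∃ y, st.seen.testBit y = true ∧
      h • dec x = dec y ∧ h • C x = C y := by
    have hgen : ∀ g ∈ J, ∀ x, st.seen.testBit x = true → g < 16 ∧ ∃ y,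
        st.seen.testBit y = true ∧ S g • dec x = dec y ∧ S g • C x = C y := by
      intro g hg x hx
      obtain ⟨h1, -, h3, h4⟩ := hC.look (look_of_seen hE hx hg)
      exact ⟨h1, act g x, h3, hact g h1 x, h4⟩
    clear hfix
    induction hh using Subgroup.closure_induction_left with
    | one => intro x hx; exact ⟨x, hx, one_smul _ _, one_smul _ _⟩
    | mul_left a ha y _ ih =>
      obtain ⟨g, hg, rfl⟩ := ha
      intro x hx
      obtain ⟨y1, h1, h2, h3⟩ := ih x hx
      obtain ⟨-, y2, k1, k2, k3⟩ := hgen g hg y1 h1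
      exact ⟨y2, k1, by rw [mul_smul, h2, k2], by rw [mul_smul, h3, k3]⟩
    | inv_mul_cancel a ha y _ ih =>
      obtain ⟨g, hg, rfl⟩ := ha
      intro x hx
      obtain ⟨y1, h1, h2, h3⟩ := ih x hx
      obtain ⟨hg', y2, k1, k2, k3⟩ := hgen g hg y1 h1
      rw [inv_eq_of_mul_eq_one_left (hS g hg')]
      exact ⟨y2, k1, by rw [mul_smul, h2, k2], by rw [mul_smul, h3, k3]⟩
  obtain ⟨y, h1, h2, h3⟩ := key E.base hC.seen_base
  rw [hfix] at h2
  -- The walk from the base point ends at the same vector, hence at the same label; so `h` fixes the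
  -- trivial coset.
  rw [← hdec _ (lt_of_seen hE hC.seen_base) _ (lt_of_seen hE h1) h2, hC.base,
    MulAction.Quotient.smul_coe, smul_eq_mul, mul_one, eq_comm, QuotientGroup.eq, inv_one,
    one_mul] at h3
  exact h3

/-- Every label is the image of the base point under an element generated by `J`. -/
theorem exists_smul_eq {V : Type*} [MulAction P V] {dec : ℕ → V}
    (hact : ∀ g < 16, ∀ x, S g • dec x = dec (act g x)) {x : ℕ}
    (hx : (E.afterTree act J).seen.testBit x = true) :
    ∃ h ∈ Subgroup.closure (Set.image S {g | g ∈ J}), h • dec E.base = dec x := by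
  rw [afterTree, run_eq] at hx
  refine foldl_preserves (Q := fun st : CosetState => ∀ x, st.seen.testBit x = true →
    ∃ h ∈ Subgroup.closure (Set.image S {g | g ∈ J}), h • dec E.base = dec x) E.tree ?_ ?_ x hx
  · intro st t _ h
    generalize t % 16 = g
    generalize t / 16 = x
    unfold define
    cases hc : J.contains g && Nat.blt g 16 && st.seen.testBit x &&
        !st.seen.testBit (act g x) && Nat.beq (act g (act g x)) x with
    | false => exact h
    | true =>
      simp only [Bool.and_eq_true, Nat.blt_eq, List.contains_iff_mem] at hc
      obtain ⟨⟨⟨⟨hJ, hg⟩, hx⟩, -⟩, -⟩ := hc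
      intro y hs
      simp only [addEdge, cond_true, testBit_or_one_shiftLeft] at hs
      rcases hs with hs | rfl
      · exact h y hs
      · obtain ⟨k, hk, hk'⟩ := h x hx
        exact ⟨S g * k, mul_mem (Subgroup.subset_closure ⟨g, hJ, rfl⟩) hk,
          by rw [mul_smul, hk', hact g hg x]⟩
  · intro x hx
    rw [seen_start, Nat.one_shiftLeft, Nat.testBit_two_pow, decide_eq_true_iff] at hx
    exact ⟨1, one_mem _, by rw [one_smul, hx]⟩

end

end Enumeration

/-! ### Transvections of `𝔽₂⁸` -/

/-- The space of the quadratic form `qMinus`. -/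
abbrev V8 : Type := Fin 8 → ZMod 2

/-- The polar form of `qMinus`. -/
abbrev pol (v w : V8) : ZMod 2 := QuadraticMap.polar qMinus v w

theorem pol_self (v : V8) : pol v v = 0 := by
  rw [pol, QuadraticMap.polar_self]
  exact CharTwo.two_nsmul _

theorem add_self_eq_zero (v : V8) : v + v = 0 := CharTwo.add_self_eq_zero v

/-- The transvection `x ↦ x + (x, v) v`. -/
def transv (v : V8) : V8 ≃ₗ[ZMod 2] V8 :=
  LinearEquiv.ofInvolutive
    { toFun := fun x => x + pol x v • v
      map_add' := fun x y => by
        rw [pol, QuadraticMap.polar_add_left]; module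
      map_smul' := fun c x => by
        rw [pol, QuadraticMap.polar_smul_left, RingHom.id_apply, smul_add, smul_assoc] }
    fun x => by
      change (x + pol x v • v) + pol (x + pol x v • v) v • v = x
      rw [pol, pol, QuadraticMap.polar_add_left, QuadraticMap.polar_smul_left, ← pol, ← pol,
        pol_self, smul_zero, add_zero, add_assoc, add_self_eq_zero, add_zero]

theorem transv_apply (v x : V8) : transv v x = x + pol x v • v := rfl

theorem transv_mul_self (v : V8) : transv v * transv v = 1 := by
  ext1 x
  exact (transv v).left_inv x

theorem zmod_two_cases (a : ZMod 2) : a = 0 ∨ a = 1 := by revert a; decide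

theorem transv_mem {v : V8} (hv : qMinus v = 1) : transv v ∈ O8Minus2 := by
  intro x
  have h : pol x v = qMinus (x + v) - qMinus x - qMinus v := rfl
  rw [transv_apply]
  rcases zmod_two_cases (pol x v) with hp | hp
  · rw [hp, zero_smul, add_zero]
  · rw [hp, hv] at h
    rw [hp, one_smul, eq_comm, ← sub_eq_zero]
    have h2 : (1 : ZMod 2) + 1 = 0 := by decide
    linear_combination h - h2

theorem pol_map {f : V8 ≃ₗ[ZMod 2] V8} (hf : f ∈ O8Minus2) (v w : V8) :
    pol (f v) (f w) = pol v w := by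
  have hf' : ∀ x, qMinus (f x) = qMinus x := hf
  simp only [pol, QuadraticMap.polar, ← map_add, hf']

theorem conj_transv {f : V8 ≃ₗ[ZMod 2] V8} (hf : f ∈ O8Minus2) (v : V8) :
    f * transv v * f⁻¹ = transv (f v) := by
  ext1 x
  have hx : f (f⁻¹ x) = x := by rw [← LinearEquiv.mul_apply, mul_inv_cancel]; rfl
  rw [LinearEquiv.mul_apply, LinearEquiv.mul_apply, transv_apply, transv_apply, map_add, map_smul,
    hx, ← pol_map hf (f⁻¹ x) v, hx]

theorem transv_inv (v : V8) : (transv v)⁻¹ = transv v :=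
  inv_eq_of_mul_eq_one_left (transv_mul_self v)

theorem transv_conj_transv {v : V8} (hv : qMinus v = 1) (w : V8) :
    transv v * transv w * transv v = transv (transv v w) := by
  rw [← conj_transv (transv_mem hv), transv_inv]

theorem transv_sq {v w : V8} (hv : qMinus v = 1) (h : pol v w = 0) :
    (transv v * transv w) ^ 2 = 1 := by
  refine mul_sq_of_commute (transv_mul_self w) ?_
  rw [transv_conj_transv hv, transv_apply, pol, QuadraticMap.polar_comm, ← pol, h, zero_smul,
    add_zero]

theorem transv_cube {v w : V8} (hv : qMinus v = 1) (hw : qMinus w = 1) (h : pol v w = 1) :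
    (transv v * transv w) ^ 3 = 1 := by
  refine mul_cube_of_braid (transv_mul_self v) (transv_mul_self w) ?_
  have h' : pol w v = 1 := by rw [pol, QuadraticMap.polar_comm, ← pol, h]
  rw [transv_conj_transv hv, transv_conj_transv hw, transv_apply, transv_apply, h, h', one_smul,
    one_smul, add_comm]

/-! ### Vectors of `𝔽₂⁸` as natural numbers -/

/-- The vector whose coordinates are the lowest eight binary digits of a number. -/
def decode (n : ℕ) : V8 := fun i => if n.testBit i then 1 else 0

theorem decode_xor (a b : ℕ) : decode (a ^^^ b) = decode a + decode b := by
  funext i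
  simp only [decode, Nat.testBit_xor, Pi.add_apply]
  cases a.testBit i <;> cases b.testBit i <;> decide

theorem decode_zero : decode 0 = 0 := by
  funext i; simp [decode]

theorem decode_injective {x y : ℕ} (hx : x < 256) (hy : y < 256) (h : decode x = decode y) :
    x = y := by
  refine Nat.eq_of_testBit_eq fun i => ?_
  by_cases hi : i < 8
  · have := congrFun h ⟨i, hi⟩
    simp only [decode] at this
    revert this
    cases x.testBit i <;> cases y.testBit i <;> decide
  · have h2 : 2 ^ 8 ≤ 2 ^ i := Nat.pow_le_pow_right (by norm_num) (not_lt.1 hi)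
    rw [Nat.testBit_lt_two_pow (hx.trans_le h2), Nat.testBit_lt_two_pow (hy.trans_le h2)]

theorem exists_decode (v : V8) : ∃ x < 256, decode x = v := by
  have hb : Function.Bijective fun x : Fin 256 => decode x := by
    rw [Fintype.bijective_iff_injective_and_card]
    exact ⟨fun x y h => Fin.ext (decode_injective x.2 y.2 h), by simp⟩
  obtain ⟨x, hx⟩ := hb.2 v
  exact ⟨x, x.2, hx⟩

/-- The quadratic form on codes: the bits of a code are the coordinates of a vector. The
values are looked up in a bit mask. -/
def codeForm (x : ℕ) : Bool :=
  Nat.testBit 54518767989058627813061742833763476615241605961821546241609016689688945653896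
    (x % 256)

/-- The polar form on codes. -/
def codePolar (x y : ℕ) : Bool := (codeForm (x ^^^ y) ^^ codeForm x) ^^ codeForm y

/-- The codes of the images of the named roots in `𝔽₂⁸`. -/
def rootCode (l : ℕ) : ℕ :=
  -- These values are linear in the roots modulo 2. The kernel is spanned by the differences of the
  -- `zₖ`, for example `b₀ + d₀ + b₁ + d₁`, so all three `zₖ` get the code 96.
  [3, 13, 19, 39, 45, 27, 7, 106, 128, 64, 152, 144, 11, 96, 96, 96].getD l 0

/-- The action of the transvection of a named root on codes. -/
def codeAct (l x : ℕ) : ℕ := bif codePolar x (rootCode l) then x ^^^ rootCode l else x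

/-- This certifies the numeral in `codeForm`. A bit equals its square, whence the linear terms in
bits 6 and 7. -/
theorem codeForm_eq_bits : ∀ x < 256, codeForm x =
    (((x.testBit 0 && x.testBit 1) ^^ (x.testBit 2 && x.testBit 3)) ^^
    ((x.testBit 4 && x.testBit 5) ^^
      ((x.testBit 6 ^^ (x.testBit 6 && x.testBit 7)) ^^ x.testBit 7))) := by
  decide +kernel

/-- The element of `𝔽₂` with a given truth value. -/
def bit (b : Bool) : ZMod 2 := if b then 1 else 0

theorem bit_injective {a b : Bool} (h : bit a = bit b) : a = b := by
  revert a b; decide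

theorem qMinus_decode (x : ℕ) : qMinus (decode x) = bit (codeForm x) := by
  have hmod : decode x = decode (x % 256) := by
    funext i
    simp only [decode, show 256 = 2 ^ 8 from rfl, Nat.testBit_mod_two_pow, i.2, decide_true,
      Bool.true_and]
  have hcode : codeForm x = codeForm (x % 256) := by
    unfold codeForm; rw [Nat.mod_mod]
  rw [hmod, hcode, codeForm_eq_bits _ (Nat.mod_lt _ (by norm_num))]
  generalize x % 256 = y
  have h : qMinus (decode y) = decode y 0 * decode y 1 + decode y 2 * decode y 3 +
      decode y 4 * decode y 5 + (decode y 6 * decode y 6 + decode y 6 * decode y 7 +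
      decode y 7 * decode y 7) := rfl
  rw [h]
  change bit (y.testBit 0) * bit (y.testBit 1) + bit (y.testBit 2) * bit (y.testBit 3) +
      bit (y.testBit 4) * bit (y.testBit 5) + (bit (y.testBit 6) * bit (y.testBit 6) +
      bit (y.testBit 6) * bit (y.testBit 7) + bit (y.testBit 7) * bit (y.testBit 7)) = _
  have hx : ∀ a b : Bool, bit (a ^^ b) = bit a + bit b := by decide
  have ha : ∀ a b : Bool, bit (a && b) = bit a * bit b := by decide
  have hi : ∀ a : Bool, bit a * bit a = bit a := by decide
  simp only [hx, ha, hi]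
  ring

theorem pol_decode (x y : ℕ) : pol (decode x) (decode y) = bit (codePolar x y) := by
  rw [pol, QuadraticMap.polar, ← decode_xor, qMinus_decode, qMinus_decode, qMinus_decode, codePolar]
  generalize codeForm (x ^^^ y) = a
  generalize codeForm x = b
  generalize codeForm y = c
  revert a b c
  decide

theorem transv_decode (l x : ℕ) :
    transv (decode (rootCode l)) (decode x) = decode (codeAct l x) := by
  rw [transv_apply, pol_decode, codeAct]
  cases codePolar x (rootCode l) with
  | false => rw [bit, if_neg Bool.false_ne_true, zero_smul, add_zero]; rfl
  | true => rw [bit, if_pos rfl, one_smul, cond_true, decode_xor]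

theorem qMinus_rootCode {l : ℕ} (hl : l < 16) : qMinus (decode (rootCode l)) = 1 := by
  have h : ∀ l < 16, codeForm (rootCode l) = true := by decide +kernel
  rw [qMinus_decode, h l hl]
  rfl

/-! ### Relators -/

/-- A rule `(k, e, c, p)` states that the element of the root `e` is the conjugate of that of the
root `c` by the product over `p`; `k` is the number of places by which the corresponding relator is
rotated. -/
abbrev Rule : Type := ℕ × ℕ × ℕ × List ℕ

/-- Whether a rule follows from the correspondence of roots and elements. -/
def Rule.valid (r : Rule) : Bool :=
  let v := r.2.2.2.foldl (fun v l => reflectCoords (rootCoords l) v) (rootCoords r.2.2.1)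
  (v == rootCoords r.2.1 || v.map (fun x => -x) == rootCoords r.2.1) &&
    r.2.2.2.foldl (fun x l => codeAct l x) (rootCode r.2.2.1) == rootCode r.2.1 &&
    Nat.blt r.2.1 16 && Nat.blt r.2.2.1 16 && r.2.2.2.all fun l => Nat.blt l 16

/-- The relator of a rule; the roots `z₀, z₁, z₂` are identified in it. -/
def Rule.relator (r : Rule) : List ℕ :=
  ((r.2.1 :: (r.2.2.2.reverse ++ r.2.2.1 :: r.2.2.2)).map fun l => min l 13).rotate r.1

/-- The rules used in the coset enumerations. -/
def ruleTable : List Rule :=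
  [(0, 6, 6, [3]), (0, 13, 13, [9]), (0, 3, 3, [6]), (0, 13, 13, [7]),
   (0, 11, 9, [8, 13, 2, 1, 0, 4]), (0, 2, 2, [4]), (0, 2, 2, [8]), (0, 0, 0, [3]),
   (0, 0, 0, [2]), (0, 8, 8, [0]), (0, 7, 0, [1, 2, 3, 11, 9, 8]), (0, 0, 0, [9]),
   (0, 13, 8, [13, 8]), (0, 3, 11, [9, 8, 7, 0, 1, 2]), (0, 6, 6, [13]),
   (0, 5, 6, [10, 1, 2, 3, 11, 4]), (0, 2, 2, [11]), (0, 8, 8, [4]),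
   (0, 7, 0, [1, 10, 6, 5, 15, 8]), (0, 2, 14, [5, 4, 0, 7, 12, 3]), (0, 11, 11, [10]),
   (0, 7, 7, [10]), (0, 11, 4, [0, 1, 2, 13, 8, 9]), (0, 8, 8, [3]),
   (0, 5, 4, [0, 7, 12, 3, 2, 14]), (0, 5, 5, [11]), (0, 6, 6, [7]),
   (0, 6, 10, [9, 8, 14, 2, 3, 12]), (0, 2, 2, [12]), (0, 4, 4, [10]),
   (0, 9, 8, [14, 2, 3, 12, 6, 10]), (0, 5, 5, [0]), (0, 5, 5, [3]), (0, 0, 0, [10]),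
   (0, 4, 4, [6]), (0, 10, 9, [8, 14, 2, 3, 12, 6]), (0, 13, 5, [13, 5]),
   (0, 1, 2, [3, 11, 9, 8, 7, 0]), (0, 4, 4, [13]), (0, 15, 2, [3, 11, 4, 0, 7, 8]),
   (0, 7, 0, [4, 5, 14, 2, 3, 12]), (0, 8, 8, [6]), (0, 1, 1, [13]), (0, 7, 7, [6]),
   (0, 2, 13, [8, 9, 11, 4, 0, 1]), (0, 3, 3, [7]), (0, 9, 9, [6]), (0, 0, 0, [13]),
   (0, 11, 11, [12]), (0, 2, 1, [0, 4, 11, 9, 8, 13]), (0, 3, 3, [4]), (0, 7, 7, [13]),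
   (0, 5, 5, [2]), (0, 9, 8, [13, 5, 6, 12, 3, 11]), (0, 3, 3, [13]),
   (0, 6, 12, [7, 0, 1, 2, 13, 5]), (0, 6, 6, [1]), (0, 1, 1, [8]), (0, 14, 14, [4]),
   (0, 10, 9, [8, 14, 5, 4, 0, 1]), (0, 0, 0, [6]), (0, 2, 1, [0, 7, 8, 9, 11, 3]),
   (0, 0, 0, [8]), (0, 9, 9, [7]), (0, 6, 10, [9, 11, 3, 2, 15, 5]), (0, 2, 2, [7]),
   (0, 4, 4, [12]), (0, 4, 0, [7, 8, 15, 2, 3, 11]), (0, 5, 5, [10]), (0, 4, 4, [9]),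
   (0, 11, 9, [8, 7, 0, 1, 2, 3]), (0, 1, 1, [4]), (0, 1, 2, [13, 8, 9, 11, 4, 0]),
   (0, 2, 2, [0]), (0, 0, 4, [5, 14, 8, 9, 10, 1]), (0, 9, 9, [1]),
   (0, 12, 7, [8, 9, 10, 1, 2, 3]), (0, 3, 11, [3, 11]), (0, 1, 1, [11]), (0, 10, 10, [11]),
   (0, 4, 11, [9, 8, 13, 2, 1, 0]), (0, 11, 11, [13]), (0, 13, 8, [9, 11, 4, 0, 1, 2]),
   (0, 10, 9, [11, 3, 2, 15, 5, 6]), (0, 12, 3, [2, 14, 5, 4, 0, 7]), (0, 12, 12, [13]),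
   (0, 0, 0, [5]), (0, 12, 6, [12, 6]), (0, 3, 3, [9]), (0, 11, 11, [8]), (0, 14, 14, [0]),
   (0, 3, 3, [8]), (0, 8, 8, [1]), (0, 11, 4, [11, 4]), (0, 1, 2, [1, 2]), (0, 8, 8, [12]),
   (0, 10, 10, [14]), (0, 7, 7, [2]), (0, 11, 11, [6]), (0, 0, 7, [8, 9, 11, 3, 2, 1]),
   (0, 8, 7, [0, 4, 11, 3, 2, 15]), (0, 9, 9, [3]), (0, 2, 2, [6]),
   (0, 12, 7, [0, 1, 2, 13, 5, 6]), (0, 0, 0, [12]), (0, 2, 2, [10]), (0, 3, 3, [10]),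
   (0, 13, 5, [6, 12, 7, 0, 1, 2]), (0, 4, 4, [2]), (1, 7, 0, [1, 2, 3, 11, 9, 8]),
   (0, 1, 1, [5]), (0, 1, 1, [7]), (0, 1, 1, [9]), (0, 4, 4, [7]), (0, 4, 4, [8]),
   (0, 5, 5, [7]), (0, 5, 5, [8]), (0, 5, 5, [9]), (0, 7, 7, [9]), (0, 8, 7, [8, 7]),
   (0, 9, 8, [9, 8]), (0, 7, 0, [7, 0]), (0, 7, 7, [1]), (0, 7, 7, [4]), (0, 7, 7, [5]),
   (0, 8, 8, [5]), (0, 9, 9, [0]), (0, 9, 9, [4]), (0, 9, 9, [5]), (0, 0, 1, [0, 1]),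
   (0, 0, 4, [0, 4]), (0, 0, 7, [0, 7]), (0, 1, 0, [1, 0]), (0, 4, 0, [4, 0]), (0, 4, 4, [1]),
   (0, 5, 4, [5, 4]), (0, 7, 8, [7, 8]), (0, 4, 5, [4, 5]), (0, 5, 5, [1]), (0, 8, 9, [8, 9])]

/-- Coset enumerations for a chain of subgroups of index `136, 56, 27, 16, 5, 4, 3, 2`; the
subgroups are generated by subdiagrams of type `E₇, E₆, D₅, A₄, A₃, A₂, A₁` of `Y₃₃₃`. -/
def cosetTables : List Enumeration :=
  -- The code 39 is that of `d₀`, one of the 136 vectors on which the form is 1; its stabilizer in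
  -- the orthogonal group is the Weyl group of `E₇`, here generated by the nodes other than `c₀` and
  -- `d₀`. The later steps enumerate cosets of Weyl groups. The product of the indices is the order
  -- 394813440 of the orthogonal group.
  [{ base := 39
     sub := [0, 1, 4, 5, 7, 8, 9]
     tree :=
      [626, 635, 636, 833, 835, 843, 844, 845, 2931, 2932, 2937, 2940, 707, 710, 711, 912, 915,
       922, 923, 924, 925, 317, 2628, 2633, 2636, 2637, 1014, 1015, 1021, 1349, 1352, 2308, 2313,
       2464, 2469, 2473, 2476, 3960, 3962, 3964, 3014, 3015, 182, 183, 693, 695, 698, 1120, 1128,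
       931, 932, 935, 938, 939, 940, 941, 482, 490, 493, 2582, 2585, 2589, 2708, 2713, 2717, 806,
       807, 813, 1426, 1429, 1432, 1842, 1845, 1848, 2192, 2197, 2204, 3656, 3658, 3660, 2803,
       2806, 2807, 2813, 3141, 3144, 901, 906, 1360, 1368, 1268, 1270, 3399, 3401, 3033, 3035,
       3339, 3500, 2326, 2327, 199, 204, 1564, 466, 474, 477, 378, 380, 1290, 1291, 2598, 2601,
       2605, 2729, 2733, 790, 797, 1442, 218, 2157, 2021, 2024, 3090, 2117, 3736, 853, 1416,
       1541, 1544, 1672, 225, 2141, 454, 3081, 2385]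
     deductions :=
      [555, 1779, 1822, 2100, 2061, 4279, 5538, 5780, 6583, 6726, 6753, 7212, 7356, 7586, 8336,
       8609, 8582, 10836, 11590, 11585, 12116, 12121, 12158, 12225, 12262, 12332, 12351, 12954,
       13364, 13476, 13908, 13913, 13914, 14804, 15526, 15760, 16084, 16710, 16854, 16940, 17084,
       17071, 16945, 17911, 17872, 17939, 18757, 19876, 20151, 20132, 20820, 20825, 20851, 20831,
       20826, 21844, 21849, 21956, 21850, 22095, 22775, 22756, 22746, 22996, 23027, 23508, 23513,
       23396, 23962, 23953, 24364, 24665, 24666, 24702, 24701, 24884, 25131, 25144, 25238, 26155,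
       26299, 26440, 26668, 26687, 26674, 26719, 26706, 27059, 27014, 27297, 27298, 27329, 27260,
       27330, 27700, 27711, 1434, 1469, 1425, 1734, 1811, 1803, 1907, 2035, 2122, 2144, 2272,
       3041, 2964, 4141, 5899, 8211, 8747, 8760, 8891, 8758, 9295, 9320, 9439, 9812, 9823, 10023,
       10539, 10508, 10948, 12937, 13140, 14020, 14946, 15143, 15403, 15416, 15372, 15413, 15432,
       17148, 17171, 18330, 18313, 18841, 19475, 19780, 19757, 20407, 21875, 22064, 22120, 22051,
       22139, 23945, 23938, 24327, 26631, 1047, 3402, 4875, 5263, 6931, 7603, 7584, 8627, 8608,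
       8979, 9843, 10259, 12316, 13171, 16104, 16737, 24691, 24928, 25115, 26124, 26214, 27744,
       52, 3668, 3699, 4948, 7263, 7175, 7274, 7699, 10227, 14393, 14425, 16423, 22315, 22328,
       22325, 24138, 25652, 25908, 30, 126, 1748, 3284, 4292, 4303, 4164, 5907, 7795, 16830,
       17395, 18570, 19257, 21145, 21300, 23194, 23609, 24383, 24370, 24660, 25527, 25764, 25940,
       25886, 26812, 27872, 474, 404, 958, 1936, 2212, 2223, 2362, 2353, 3063, 3044, 3024, 3289,
       3140, 4489, 4375, 4380, 5918, 5917, 8559, 8572, 10552, 10549, 10550, 10523, 12228, 12239,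
       15031, 15095, 15547, 15528, 15991, 15972, 15940, 16567, 16548, 19289, 20388, 20420, 22239,
       22459, 22440, 23721, 23684, 24495, 24450, 25783, 25982, 26876, 26863, 144, 1928, 2442,
       3326, 3780, 4506, 4791, 6032, 6077, 6024, 10664, 14505, 14537, 24508, 24465, 24996, 2457,
       10683, 10646, 13252, 17364, 17812, 18585, 19353, 23700, 3034, 11412, 1271, 2045, 2522,
       2557, 3325, 5231, 12540, 12602, 15056, 15824, 16720, 18745, 19486, 19776, 21886, 22903,
       24529, 27041, 27042, 27080, 400, 445, 1303, 1533, 1423, 1661, 3281, 4265, 4266, 4160,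
       4288, 5785, 7218, 7217, 7196, 15100, 16728, 17950, 18814, 18942, 19881, 20862, 21392,
       22761, 23038, 23401, 26278, 26165, 26277, 26166, 26139, 27110, 27109, 1412, 1752, 2617,
       2590, 5254, 5350, 5537, 5510, 9530, 9501, 10842, 10877, 11174, 12932, 13145, 13182, 13249,
       13286, 14025, 14810, 14845, 17949, 18423, 18384, 18199, 19882, 20138, 20032, 20170, 20537,
       20861, 22762, 23037, 23940, 24845, 24906, 24981, 25042, 3342, 3401, 3897, 5253, 5349,
       6569, 7585, 7994, 8222, 8221, 8870, 9282, 9317, 9817, 9921, 13325, 13326, 14026, 14109,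
       14711, 16946, 16978, 17569, 17570, 17542, 17541, 17557, 17889, 17934, 21584, 26397, 27406,
       27722, 27858, 58, 3674, 3709, 6570, 6736, 8757, 14094, 14339, 21885, 22326, 23053, 26382,
       9110, 17558, 27030, 27286, 27816, 657, 2198, 2453, 4485, 6050, 7694, 10133, 10661, 11771,
       12988, 12987, 12968, 13612, 16198, 19203, 19768, 23190, 23704, 25867, 25953, 27296, 136,
       575, 1935, 2465, 2438, 2470, 4495, 8471, 8840, 11605, 11734, 11819, 11788, 11841, 11878,
       12930, 13613, 13919, 15035, 23509, 25224, 26248, 26652, 130, 6207, 6575, 7709, 8328,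
       10182, 10197, 13254, 13356, 13500, 15387, 20606, 21589, 25045, 25914, 3142, 3782, 6214,
       7654, 8005, 8203, 8289, 8902, 9758, 9862, 10561, 13397, 13398, 16208, 23109, 27661, 27861,
       27797, 812, 3137, 5990, 21574, 22886, 25185, 811, 3174, 9023, 11416, 12394, 20399, 21144,
       24198, 24671, 24783, 780, 7743, 9004, 9558, 10982, 11832, 14149, 14694, 15425, 16213,
       20412, 21317, 26437, 2370, 8001, 8294, 21318, 21345, 22118, 2405, 13705, 17892, 18789,
       19396, 21066, 21065, 22885, 23362, 24036, 393, 484, 2948, 3172, 3177, 5244, 9924, 10980,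
       11497, 12527, 12649, 14692, 20580, 20969, 22175, 22884, 22889, 2729, 4553, 13257, 14660,
       23001, 1754, 2749, 2713, 2708, 3466, 4048, 4313, 6464, 8439, 11673, 16318, 16592, 17519,
       18138, 18058, 20697, 21747, 25050, 24970, 27850, 247, 1527, 1655, 1981, 2249, 2378, 2494,
       2714, 6356, 6495, 7155, 7420, 9203, 9661, 9898, 11744, 12201, 13540, 16612, 16596, 17305,
       17290, 17532, 17898, 18320, 20013, 20599, 20670, 21460, 21694, 21728, 23392, 24969, 25614,
       26991, 2474, 2317, 3049, 3716, 3959, 4752, 5866, 6809, 6846, 7136, 9014, 9184, 9375,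
       13289, 13412, 14250, 14473, 14569, 14553, 14484, 14967, 17918, 18666, 18922, 19649, 20292,
       21130, 21921, 22438, 22405, 23555, 25408, 26512, 254, 3786, 6378, 6794, 7734, 8169, 9158,
       9362, 11825, 12449, 12481, 19761, 19793, 20393, 20425, 21481, 21958, 21989, 22849, 23505,
       24713, 24742, 25254, 566, 3818, 5425, 5457, 6449, 6609, 7548, 7878, 7846, 7986, 9516,
       9484, 11062, 13052, 12828, 12827, 14148, 14409, 14972, 16397, 16530, 18684, 18459, 19664,
       20156, 21394, 21879, 22726, 24572, 24708, 25496, 225, 5985, 6997, 8789, 8850, 9045, 9042,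
       9483, 10200, 10642, 11064, 11233, 11154, 11602, 11858, 13874, 14716, 15505, 16705, 18321,
       18385, 18230, 18257, 18754, 19557, 20033, 20134, 20161, 20632, 21301, 21755, 23009, 23185,
       24626, 24898, 26337, 27718, 27759, 27713, 565, 824, 1019, 1176, 1745, 2257, 2386, 3282,
       3679, 4740, 5170, 5202, 5536, 5404, 5858, 6816, 7730, 7733, 8081, 8137, 8792, 10341,
       10913, 10950, 10801, 10780, 11103, 11077, 11035, 11608, 12120, 13284, 13180, 13465, 13530,
       13394, 13386, 13529, 14662, 15036, 14959, 15209, 16088, 16223, 16216, 16602, 17216, 17254,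
       18914, 19590, 19669, 19709, 19710, 21056, 21393, 21378, 21413, 21718, 21701, 21664, 21848,
       21990, 22145, 22850, 23506, 23512, 25079, 24943, 25011, 24918, 25141, 26518, 26533, 26517,
       27887, 253, 853, 982, 947, 2433, 4463, 6835, 7018, 7810, 8382, 8445, 8446, 8801, 9185,
       9066, 9262, 9651, 10359, 10492, 10263, 10479, 10447, 10493, 11639, 11699, 11759, 13642,
       13641, 14199, 14154, 14180, 14126, 14441, 15087, 15190, 16247, 16307, 16448, 17002, 17344,
       17792, 18607, 18561, 18671, 18568, 18817, 19375, 19268, 19904, 20031, 21386, 21294, 21683,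
       21590, 21704, 21892, 22408, 22374, 22656, 23126, 23731, 24224, 24214, 24695, 24810, 24961,
       24932, 25992, 26021, 26537, 26593, 26434, 26414, 27777, 386, 965, 1872, 1992, 3607, 3781,
       3670, 3810, 3988, 4032, 5519, 6096, 6396, 6341, 6370, 6480, 6908, 6863, 7791, 7749, 7703,
       7887, 7766, 7786, 7708, 8125, 8161, 8371, 8390, 9211, 9552, 9679, 9935, 10081, 10565,
       10847, 10882, 11144, 11176, 11717, 11842, 11973, 11857, 11803, 12230, 13499, 13526, 13551,
       13525, 13658, 13692, 13693, 13669, 13910, 14209, 14293, 15293, 15257, 15169, 15240, 15330,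
       15611, 16228, 16598, 17608, 17864, 17931, 18005, 18363, 18344, 19305, 19645, 20011, 20024,
       20160, 20421, 20269, 20433, 20934, 21377, 21466, 21462, 21322, 21461, 21615, 21737, 21705,
       22299, 22853, 23169, 24426, 25019, 25158, 25217, 25100, 25176, 25339, 25814, 26521, 26497,
       26585, 641, 779, 936, 1173, 2262, 2776, 3178, 3477, 3480, 3992, 5133, 6156, 6488, 6445,
       7101, 7504, 7809, 7825, 7894, 7693, 7818, 8918, 9150, 9251, 9261, 9557, 9686, 9697, 9715,
       9669, 9723, 9696, 10247, 11267, 12434, 12295, 14234, 14128, 14115, 14239, 14707, 14689,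
       14688, 14805, 14698, 15107, 15978, 16316, 16315, 16288, 17164, 18016, 18144, 19552, 19608,
       20312, 20491, 20548, 20696, 20995, 21402, 21259, 21435, 21260, 21350, 22061, 23402, 25247,
       25645, 26271, 26416, 26433, 26403, 26516, 27149, 27171, 28064, 658, 671, 2350, 2605, 3331,
       4091, 3946, 3945, 4738, 4676, 5299, 5546, 5411, 5635, 6895, 6848, 7008, 7459, 7826, 7715,
       8640, 8901, 8863, 9056, 9192, 9507, 9704, 10448, 10392, 10655, 10771, 11167, 11515, 11310,
       11727, 11566, 11944, 11989, 13555, 14696, 14984, 15356, 15208, 15131, 16174, 16903, 18110,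
       18152, 19304, 19416, 19469, 19501, 19648, 19672, 19688, 19459, 20549, 21296, 22888, 23587,
       26928, 27184, 27552, 27696, 480, 2664, 2944, 3712, 4400, 5168, 5424, 6360, 6957, 7728,
       7776, 9520, 10032, 10880, 12672, 13290, 14303, 15357, 18048, 21608, 21888, 24704, 25664,
       26335, 26580, 28032, 735, 2624, 3168, 3968, 8927, 9183, 10463, 10591, 11283, 11999, 13632,
       14191, 14204, 14815, 15168, 15256, 18064, 18445, 18578, 19520, 19751, 20525, 21456, 21371,
       22395, 25211, 26216, 26952, 27247, 27734, 591, 635, 2665, 4603, 4731, 4943, 5192, 5448,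
       5967, 5960, 6147, 6472, 6919, 7496, 7752, 7803, 9039, 8967, 9541, 9595, 10056, 10107,
       11087, 11855, 12869, 14671, 15714, 17415, 17999, 18018, 18287, 19041, 18947, 19298, 19535,
       19554, 20526, 21515, 23650, 27143, 98, 2658, 2666, 3938, 3867, 7687, 9058, 9223, 9479] },
   { base := 139
     sub := [0, 1, 4, 5, 7, 8]
     tree :=
      [2233, 3256, 1207, 528, 545, 548, 756, 245, 32, 37, 21, 23, 420, 423, 1720, 887, 1800,
       3769, 1488, 1496, 3849, 1505, 1512, 3545, 1336, 3559, 3561, 3383, 3385, 2889, 2960, 2969,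
       3912, 2980, 2985, 3992, 2421, 2425, 4008, 2249, 3448, 1959, 3272, 1399, 1223, 976, 608,
       993, 593, 596, 644, 80, 103, 1736, 3785]
     deductions :=
      [22041, 16093, 3019, 2973, 3065, 18191, 18184, 14814, 17867, 17914, 28180, 28596, 28875,
       28830, 28916, 29040, 29259, 29424, 29306, 29547, 29931, 30155, 30123, 30167, 30411, 30366,
       30355, 30497, 30795, 15947, 15993, 14667, 14708, 17840, 2338, 23599, 4367, 4354, 16161,
       28449, 28961, 28944, 29771, 29783, 31010, 31279, 31503, 31490, 31764, 31769, 32020, 32025,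
       32290, 32527, 32788, 2305, 2330, 4407, 19247, 19202, 19225, 33071, 33295, 33643, 33648,
       33793, 28186, 28523, 28528, 34049, 34142, 34387, 29035, 29419, 29406, 29395, 34615, 34653,
       34781, 29473, 29501, 30109, 35051, 35056, 35037, 30379, 30384, 30365, 32257, 32282, 32567,
       22036, 16107, 16112, 2987, 2992, 18231, 18269, 14827, 14832, 14813, 17835, 17822, 17811,
       7970, 8030, 8158, 8094, 7998, 16235, 16240, 16221, 33107, 33235, 33716, 33780, 33978,
       34042, 28843, 28848, 28829, 35092, 29108, 29113, 29172, 29177, 29300, 29305, 35375, 35411,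
       35539, 35475, 35379, 29620, 29625, 29684, 29689, 29812, 29817, 31162, 31639, 31884, 30458,
       30423, 30412, 30480, 30525, 30502, 35755, 35760, 35741, 32350, 15988, 2963, 18327, 18391,
       14714, 14679, 8122, 8186, 8058, 2462, 2366, 2341, 23699, 23603, 23592, 4360, 4357, 19283,
       33431, 33495, 33367, 28300, 28364, 28236, 28432, 28477, 28454, 34329, 35212, 35276, 35148,
       28966, 34576, 31038, 31283, 31781, 31784, 34932, 34937, 22156, 22220, 22092, 2310, 33075,
       33064, 33335, 33288, 33552, 33798, 28524, 34110, 34054, 34355, 29036, 29420, 34568, 34565,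
       31070, 31315, 31496, 31493, 35052, 30380, 30644, 30649, 30836, 30841, 14828, 17836, 7942,
       2490, 4503, 33644, 28844, 29548, 29932, 30124, 32140, 32378, 32599, 32844, 16108, 2988,
       16144, 16189, 16166, 32318, 32293, 32520, 19251, 19240, 19205, 32262, 16236, 35756] },
   { base := 64
     sub := [0, 1, 4, 5, 7]
     tree :=
      [1032, 3079, 2720, 2705, 2708, 2628, 2117, 2192, 2197, 2213, 2215, 2324, 2327, 3592, 3015,
       4024, 3424, 3432, 3409, 3416, 3464, 1367, 1415, 800, 788, 453]
     deductions :=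
      [22162, 16064, 15958, 18308, 28319, 14784, 14677, 29179, 29376, 29307, 29664, 29888, 29792,
       31145, 31396, 31620, 31625, 31903, 31890, 30634, 33760, 33787, 15968, 15995, 28586, 28479,
       34261, 34133, 34520, 34392, 29098, 28991, 28978, 29610, 2473, 23716, 4484, 4489, 32159,
       32146, 33188, 33412, 33308, 22175, 22023, 33930, 33937, 18364, 28640, 28667, 28630, 14688,
       14715, 14678, 34186, 29152, 29280, 8105, 35492, 34748, 34774, 34646, 2442, 2449, 4540,
       33240, 33112, 35231, 35218, 8149, 8021, 35544, 35416, 29503, 29490, 31025, 31516, 31751,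
       34912, 34939, 34902, 33468, 33599, 33841, 18204, 28167, 7985, 31189, 31448, 30527, 30514,
       35079, 2353, 4380, 32007] },
   { base := 11
     sub := [0, 1, 4, 5]
     tree :=
      [183, 1552, 1569, 1572, 1780, 1269, 1056, 1061, 1045, 1047, 1444, 1447, 1911, 464, 481]
     deductions :=
      [22105, 18255, 28244, 28513, 29025, 28976, 29537, 29483, 31074, 31343, 31567, 31554, 31828,
       31833, 33135, 33359, 22100, 33579, 33584, 33857, 33882, 18295, 28459, 28464, 28445, 34113,
       34078, 34323, 28971, 8034, 35439, 34679, 34589, 33043, 35156, 35161, 7966, 35347, 33399,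
       31006, 31251] },
   { base := 7
     sub := [0, 1, 4]
     tree :=
      [117, 452, 784, 801]
     deductions :=
      [22044, 28188, 34098, 34367, 34609, 18225, 7986, 35391, 33087] },
   { base := 16
     sub := [0, 1]
     tree :=
      [260, 976, 993]
     deductions :=
      [18237, 34110, 34355, 33075] },
   { base := 3
     sub := [0]
     tree :=
      [49, 224]
     deductions :=
      [33805] },
   { base := 1
     sub := []
     tree :=
      [16]
     deductions :=
      [] }]

/-- The relators of the rule table. -/
def relatorTable : List (List ℕ) := ruleTable.map Rule.relator

theorem ruleTable_valid : ruleTable.all Rule.valid = true := by decide +kernel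

/-- Check a chain of enumerations, each for the subgroup of the preceding one, down to the trivial
subgroup. -/
def checkChain : List ℕ → List Enumeration → Bool
  | J, [] => J.isEmpty
  | J, E :: L => E.check codeAct relatorTable J && checkChain E.sub L

theorem checkChain_cosetTables : checkChain (List.range 14) cosetTables = true := by
  decide +kernel

/-- The codes of the sums of sublists of a list of codes. -/
def sums : List ℕ → List ℕ
  | [] => [0]
  | y :: F => sums F ++ (sums F).map fun x => y ^^^ x

/-- Check that the base points of a chain of enumerations are the members of a basis, and that each
orbit in the chain contains every vector outside the span of the preceding base points that agrees
with the base point in the values of the quadratic form and of the polar forms with the preceding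
base points. -/
def checkOrbits : List ℕ → List ℕ → List Enumeration → Bool
  | _, F, [] => (List.range 8).all fun i => (sums F).contains (1 <<< i)
  | J, F, E :: L =>
    (J.all fun g => Nat.blt g 16 && F.all fun y => codeAct g y == y) && E.sub.all J.contains &&
    (Nat.blt E.base 256 && !(sums F).contains E.base) &&
    ((List.range 256).all fun x =>
      !(codeForm x == codeForm E.base && F.all fun y => codePolar x y == codePolar E.base y) ||
      ((sums F).contains x || (E.afterTree codeAct J).seen.testBit x)) &&
    checkOrbits E.sub (E.base :: F) L

theorem checkOrbits_cosetTables : checkOrbits (List.range 14) [] cosetTables = true := by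
  decide +kernel

theorem fixes_sums {F : List ℕ} {f : V8 ≃ₗ[ZMod 2] V8} (hF : ∀ y ∈ F, f (decode y) = decode y) :
    ∀ y ∈ sums F, f (decode y) = decode y := by
  induction F with
  | nil =>
    intro y hy
    rw [sums, List.mem_singleton] at hy
    rw [hy, decode_zero, map_zero]
  | cons z F ih =>
    intro y hy
    have ih' := ih fun y hy => hF y (List.mem_cons_of_mem _ hy)
    rw [sums, List.mem_append, List.mem_map] at hy
    rcases hy with hy | ⟨x, hx, rfl⟩
    · exact ih' y hy
    · rw [decode_xor, map_add, hF z List.mem_cons_self, ih' x hx]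

theorem eq_one_of_fixes_sums {F : List ℕ} {f : V8 ≃ₗ[ZMod 2] V8}
    (hF : ∀ y ∈ F, f (decode y) = decode y)
    (hspan : ((List.range 8).all fun i => (sums F).contains (1 <<< i)) = true) : f = 1 := by
  rw [List.all_eq_true] at hspan
  have hbasis : ∀ i : Fin 8, decode (1 <<< (i : ℕ)) = Pi.single i 1 := by decide
  refine LinearEquiv.toLinearMap_injective ((Pi.basisFun (ZMod 2) (Fin 8)).ext fun i => ?_)
  have h1 := hspan i (List.mem_range.2 i.2)
  rw [List.contains_iff_mem] at h1
  rw [Pi.basisFun_apply, ← hbasis]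
  exact fixes_sums hF _ h1

/-! ### The group generated by the pairs of corresponding elements -/

section Pairs

variable {G : Type*} [Group G] (s : Node → G)

/-- The element of a named root, paired with the transvection of the image of the root in
`𝔽₂⁸`. -/
def pairElt (l : ℕ) : G × (V8 ≃ₗ[ZMod 2] V8) := (namedElt s l, transv (decode (rootCode l)))

variable {s}

/-- The group generated by the pairs of the named roots in `J`. -/
def pairGroup (s : Node → G) (J : List ℕ) : Subgroup (G × (V8 ≃ₗ[ZMod 2] V8)) :=
  Subgroup.closure (Set.image (pairElt s) {g | g ∈ J})

theorem pairElt_mem {J : List ℕ} {g : ℕ} (hg : g ∈ J) : pairElt s g ∈ pairGroup s J :=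
  Subgroup.subset_closure ⟨g, hg, rfl⟩

theorem pairGroup_mono {J J' : List ℕ} (h : ∀ g ∈ J, g ∈ J') : pairGroup s J ≤ pairGroup s J' :=
  Subgroup.closure_mono (Set.image_mono h)

theorem snd_mem {J : List ℕ} (hJ : ∀ g ∈ J, g < 16) {h : G × (V8 ≃ₗ[ZMod 2] V8)}
    (hh : h ∈ pairGroup s J) : h.2 ∈ O8Minus2 := by
  have : pairGroup s J ≤ O8Minus2.comap (MonoidHom.snd G (V8 ≃ₗ[ZMod 2] V8)) := by
    rw [pairGroup, Subgroup.closure_le]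
    rintro _ ⟨g, hg, rfl⟩
    exact transv_mem (qMinus_rootCode (hJ g hg))
  exact this hh

theorem snd_fixes {J : List ℕ} {y : ℕ} (hJ : ∀ g ∈ J, codeAct g y = y)
    {h : G × (V8 ≃ₗ[ZMod 2] V8)} (hh : h ∈ pairGroup s J) : h.2 (decode y) = decode y := by
  have : pairGroup s J ≤ (MulAction.stabilizer (V8 ≃ₗ[ZMod 2] V8) (decode y)).comap
      (MonoidHom.snd G (V8 ≃ₗ[ZMod 2] V8)) := by
    rw [pairGroup, Subgroup.closure_le]
    rintro _ ⟨g, hg, rfl⟩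
    change transv (decode (rootCode g)) (decode y) = decode y
    rw [transv_decode, hJ g hg]
  exact this hh

/-- Through the second component, pairs act on the vectors. -/
abbrev pairAction : MulAction (G × (V8 ≃ₗ[ZMod 2] V8)) V8 :=
  MulAction.compHom V8 (MonoidHom.snd G (V8 ≃ₗ[ZMod 2] V8))

/-- An isometry that fixes the base points before a chain of enumerations is the second component
of a member of the group at the top of the chain. -/
theorem exists_snd_eq (L : List Enumeration) (J F : List ℕ) (hL : checkOrbits J F L = true)
    {f : V8 ≃ₗ[ZMod 2] V8} (hf : f ∈ O8Minus2) (hF : ∀ y ∈ F, f (decode y) = decode y) :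
    ∃ h ∈ pairGroup s J, h.2 = f := by
  induction L generalizing J F f with
  | nil =>
    rw [checkOrbits] at hL
    exact ⟨1, one_mem _, (eq_one_of_fixes_sums hF hL).symm⟩
  | cons E L ih =>
    simp only [checkOrbits, Bool.and_eq_true, List.all_eq_true, Nat.blt_eq, beq_iff_eq,
      Bool.or_eq_true, List.contains_iff_mem, List.mem_range] at hL
    obtain ⟨⟨⟨⟨hJ, hsub⟩, hbase, hnot⟩, horb⟩, hL⟩ := hL
    obtain ⟨x, hx, hfx⟩ := exists_decode (f (decode E.base))
    have hnot' : E.base ∉ sums F := by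
      intro h
      rw [← List.contains_iff_mem] at h
      rw [h] at hnot
      exact Bool.noConfusion hnot
    -- The vector `f (decode E.base)` agrees with the base point in the form and in its polar values
    -- with the fixed vectors, and by injectivity of `f` it lies outside their span. The orbit check
    -- covers exactly such vectors.
    have hseen : (E.afterTree codeAct J).seen.testBit x = true := by
      rcases horb x hx with h | h | h
      · exfalso
        have h1 : codeForm x = codeForm E.base := by
          apply bit_injective
          rw [← qMinus_decode, ← qMinus_decode, hfx]
          exact hf _
        have h2 : ∀ y ∈ F, codePolar x y = codePolar E.base y := by
          intro y hy
          apply bit_injective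
          rw [← pol_decode, ← pol_decode, hfx]
          conv_lhs => rw [← hF y hy]
          exact pol_map hf _ _
        have h3 : (codeForm x == codeForm E.base &&
            F.all fun y => codePolar x y == codePolar E.base y) = true := by
          simpa using ⟨h1, h2⟩
        rw [h3] at h
        exact Bool.noConfusion h
      · have h1 := fixes_sums hF x h
        have h2 := f.injective (h1.trans hfx)
        rw [decode_injective hx hbase h2] at h
        exact absurd h hnot'
      · exact h
    let _ := pairAction (G := G)
    obtain ⟨h, hh, hhx⟩ := Enumeration.exists_smul_eq (act := codeAct) (S := pairElt s) (J := J)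
      (E := E) (dec := decode) (fun g _ x => transv_decode g x) hseen
    have hhx' : h.2 (decode E.base) = f (decode E.base) := hhx.trans hfx
    have hh2 : h.2 ∈ O8Minus2 := snd_mem (fun g hg => (hJ g hg).1) hh
    -- Dividing by `h.2` gives an isometry that also fixes the new base point.
    obtain ⟨k, hk, hk2⟩ := ih E.sub (E.base :: F) hL (f := h.2⁻¹ * f)
      (mul_mem (inv_mem hh2) hf) (by
        have hcancel : ∀ v w, h.2 v = w → h.2⁻¹ w = v := by
          rintro v _ rfl
          rw [← LinearEquiv.mul_apply, inv_mul_cancel]; rfl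
        intro y hy
        rw [LinearEquiv.mul_apply]
        apply hcancel
        rcases List.mem_cons.1 hy with rfl | hy
        · exact hhx'
        · rw [hF y hy]
          exact snd_fixes (fun g hg => (hJ g hg).2 y hy) hh)
    refine ⟨h * k, mul_mem hh (pairGroup_mono hsub hk), ?_⟩
    rw [Prod.snd_mul, hk2, mul_inv_cancel_left]

section Coxeter

variable (hcox : SatisfiesCoxeter y333 s)
include hcox

theorem pairElt_mul_self {l : ℕ} (hl : l < 16) : pairElt s l * pairElt s l = 1 :=
  Prod.ext (namedElt_mul_self hcox hl) (transv_mul_self _)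

/-- Conjugation of the pair of a root by a product of pairs. -/
theorem conj_pairElt (p : List ℕ) (hp : ∀ l ∈ p, l < 16) (v : List ℤ) (hv : v.length = 10) (x : ℕ)
    (h : G × (V8 ≃ₗ[ZMod 2] V8)) (h1 : RootElt s (ofCoords v) h.1)
    (h2 : h.2 = transv (decode x)) :
    (p.foldl (fun v l => reflectCoords (rootCoords l) v) v).length = 10 ∧
    RootElt s (ofCoords (p.foldl (fun v l => reflectCoords (rootCoords l) v) v))
      ((p.map (pairElt s)).reverse.prod * h * (p.map (pairElt s)).prod).1 ∧
    ((p.map (pairElt s)).reverse.prod * h * (p.map (pairElt s)).prod).2 =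
      transv (decode (p.foldl (fun x l => codeAct l x) x)) := by
  induction p generalizing v x h with
  | nil => simpa using ⟨hv, h1, h2⟩
  | cons l p ih =>
    have hl := hp l List.mem_cons_self
    have hr := length_rootCoords l hl
    have := ih (fun l hl => hp l (List.mem_cons_of_mem _ hl)) (reflectCoords (rootCoords l) v)
      (length_reflectCoords hr hv) (codeAct l x) (pairElt s l * h * pairElt s l)
      (by
        rw [ofCoords_reflectCoords hr hv]
        exact (rootElt_namedElt hcox hl).reflect hcox h1)
      (by
        rw [Prod.snd_mul, Prod.snd_mul, h2]
        exact (transv_conj_transv (qMinus_rootCode hl) _).trans (by rw [transv_decode]))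
    simpa only [List.foldl_cons, List.map_cons, List.reverse_cons, List.prod_append,
      List.prod_cons, List.prod_nil, mul_one, mul_assoc] using this

/-- The relation holds in both components: in `G` because a root, up to sign, determines its
element, and for transvections because a vector determines its transvection. The equality of the
`zₖ` enters through `min l 13`. -/
theorem prod_relator (hz : ∀ l < 16, 13 ≤ l → namedElt s l = namedElt s 13) {r : Rule}
    (hr : r.valid = true) : (r.relator.map (pairElt s)).prod = 1 ∧ ∀ g ∈ r.relator, g < 16 := by
  obtain ⟨k, e, c, p⟩ := r
  simp only [Rule.valid, Bool.and_eq_true, Bool.or_eq_true, beq_iff_eq, Nat.blt_eq,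
    List.all_eq_true] at hr
  obtain ⟨⟨⟨⟨hroot, hcode⟩, he⟩, hc⟩, hp⟩ := hr
  have hmin : ∀ l < 16, pairElt s (min l 13) = pairElt s l := by
    intro l hl
    rcases lt_or_ge l 13 with h | h
    · rw [min_eq_left h.le]
    · rw [min_eq_right h]
      refine Prod.ext (hz l hl h).symm ?_
      have : ∀ l < 16, 13 ≤ l → rootCode l = rootCode 13 := by decide +kernel
      change transv (decode (rootCode 13)) = transv (decode (rootCode l))
      rw [this l hl h]
  have hlt : ∀ l ∈ e :: (p.reverse ++ c :: p), l < 16 := by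
    intro l hl
    simp only [List.mem_cons, List.mem_append, List.mem_reverse] at hl
    rcases hl with rfl | hl | rfl | hl
    · exact he
    · exact hp l hl
    · exact hc
    · exact hp l hl
  constructor
  · rw [Rule.relator, List.map_rotate]
    apply List.prod_rotate_eq_one_of_prod_eq_one
    dsimp only
    rw [List.map_map, List.map_congr_left (f := pairElt s ∘ fun l => min l 13) (g := pairElt s)
      fun l hl => hmin l (hlt l hl)]
    obtain ⟨h0, h1, h2⟩ := conj_pairElt hcox p hp (rootCoords c) (length_rootCoords c hc)
      (rootCode c) (pairElt s c) (rootElt_namedElt hcox hc) rfl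
    have heq : (p.map (pairElt s)).reverse.prod * pairElt s c * (p.map (pairElt s)).prod =
        pairElt s e := by
      refine Prod.ext ?_ ?_
      · have h3 := rootElt_namedElt hcox he
        rcases hroot with h | h
        · rw [h] at h1
          exact h1.unique hcox h3
        · refine h1.neg.unique hcox (g' := namedElt s e) ?_
          rw [← h] at h3
          convert h3 using 1
          funext n
          have hn : nodeIndex n < 10 := by revert n; decide
          simp [ofCoords, List.getD_eq_getElem?_getD, h0, hn]
      · rw [h2, hcode]
        rfl
    rw [List.map_cons, List.prod_cons, List.map_append, List.prod_append, List.map_cons,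
      List.prod_cons, List.map_reverse, ← mul_assoc (List.prod _), heq, pairElt_mul_self hcox he]
  · intro g hg
    rw [Rule.relator, List.mem_rotate, List.mem_map] at hg
    obtain ⟨l, hl, rfl⟩ := hg
    exact (min_le_left _ _).trans_lt (hlt l hl)

variable (hz : ∀ l < 16, 13 ≤ l → namedElt s l = namedElt s 13)
include hz

/-- An element acting trivially on `V8` fixes every base point, so each enumeration in turn places
it in the next smaller subgroup, the last of which is trivial. -/
theorem eq_one_of_snd_eq_one (L : List Enumeration) (J : List ℕ) (hL : checkChain J L = true)
    {h : G × (V8 ≃ₗ[ZMod 2] V8)} (hh : h ∈ pairGroup s J) (h2 : h.2 = 1) : h = 1 := by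
  induction L generalizing J with
  | nil =>
    rw [checkChain, List.isEmpty_iff] at hL
    subst hL
    simpa [pairGroup] using hh
  | cons E L ih =>
    rw [checkChain, Bool.and_eq_true] at hL
    refine ih E.sub hL.2 ?_
    let _ := pairAction (G := G)
    refine Enumeration.mem_of_fixes (dec := decode) (fun g hg => pairElt_mul_self hcox hg) ?_
      (fun x hx y hy => decode_injective hx hy) (fun g _ x => transv_decode g x) hL.1 hh ?_
    · intro r hr
      obtain ⟨q, hq, rfl⟩ := List.mem_map.1 hr
      exact prod_relator hcox hz (List.all_eq_true.1 ruleTable_valid q hq)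
    · change h.2 (decode E.base) = decode E.base
      rw [h2]
      rfl

theorem eq_one_of_mem_pairGroup {h : G × (V8 ≃ₗ[ZMod 2] V8)} (hh : h ∈ pairGroup s (List.range 14))
    (h2 : h.2 = 1) : h = 1 :=
  eq_one_of_snd_eq_one hcox hz cosetTables _ checkChain_cosetTables hh h2

end Coxeter

/-! ### Both projections of the group of pairs are isomorphisms -/

theorem exists_moved_rootCode {f : V8 ≃ₗ[ZMod 2] V8} (hf : f ≠ 1) :
    ∃ l < 10, f (decode (rootCode l)) ≠ decode (rootCode l) := by
  by_contra! hall
  refine hf (eq_one_of_fixes_sums (F := (List.range 10).map rootCode) ?_ (by decide +kernel))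
  intro y hy
  obtain ⟨l, hl, rfl⟩ := List.mem_map.1 hy
  exact hall l (List.mem_range.1 hl)

/-- The form is nondegenerate and the thirteen other codes still span, so the case `w = l` can be
avoided; it must be, because two distinct nodes are going to be compared. -/
theorem exists_separating : ∀ l < 10, ∀ x < 256, x ≠ rootCode l → ∃ w < 14, w ≠ l ∧
    codePolar x (rootCode w) ≠ codePolar (rootCode l) (rootCode w) := by
  decide +kernel

variable (hG : 2 < ENat.card G) (hgen : Subgroup.closure (Set.range s) = ⊤)
  (hcox : SatisfiesCoxeter y333 s)
  (hz : ∀ l < 16, 13 ≤ l → namedElt s l = namedElt s 13)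
include hG hgen hcox hz

/-- If `h = (1, f)` moves the vector of the node `l` to `x`, conjugation pairs the same element of
`G` with the transvections of both vectors. A root `w` orthogonal to just one of them then gives
both a relation of exponent 2 and one of exponent 3 between the nodes `l` and `w`, which would
coincide. -/
theorem eq_one_of_fst_eq_one {h : G × (V8 ≃ₗ[ZMod 2] V8)} (hh : h ∈ pairGroup s (List.range 14))
    (h1 : h.1 = 1) : h = 1 := by
  refine eq_one_of_mem_pairGroup hcox hz hh ?_
  by_contra h2
  obtain ⟨l, hl, hne⟩ := exists_moved_rootCode h2
  obtain ⟨x, hx, hfx⟩ := exists_decode (h.2 (decode (rootCode l)))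
  obtain ⟨w, hw, hwl, hsep⟩ := exists_separating l hl x hx (by
    rintro rfl
    exact hne hfx.symm)
  have hO : h.2 ∈ O8Minus2 := snd_mem (fun g hg => by rw [List.mem_range] at hg; omega) hh
  have hmem : ∀ {l}, l < 14 → pairElt s l ∈ pairGroup s (List.range 14) := fun hl =>
    pairElt_mem (List.mem_range.2 hl)
  have hk : (namedElt s l, transv (decode x)) ∈ pairGroup s (List.range 14) := by
    have hc := mul_mem (mul_mem hh (hmem (show l < 14 by omega))) (inv_mem hh)
    convert hc using 1
    refine Prod.ext ?_ ?_
    · rw [Prod.fst_mul, Prod.fst_mul, Prod.fst_inv, h1, one_mul, inv_one, mul_one]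
      rfl
    · rw [Prod.snd_mul, Prod.snd_mul, Prod.snd_inv, hfx]
      exact (conj_transv hO _).symm
  have hqw : qMinus (decode (rootCode w)) = 1 := qMinus_rootCode (by omega)
  have hql : qMinus (decode (rootCode l)) = 1 := qMinus_rootCode (by omega)
  have hqx : qMinus (decode x) = 1 := by rw [hfx, ← hql]; exact hO _
  have hsq : ∀ y, (namedElt s l, transv (decode y)) ∈ pairGroup s (List.range 14) →
      qMinus (decode y) = 1 → codePolar y (rootCode w) = false →
      (namedElt s l * namedElt s w) ^ 2 = 1 := by
    intro y hy hq hp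
    -- A relation between transvections lifts to the pairs, hence to `G`, by injectivity of the
    -- second projection.
    refine congrArg Prod.fst (eq_one_of_mem_pairGroup hcox hz
      (pow_mem (mul_mem hy (hmem hw)) 2) ?_)
    exact transv_sq hq (by rw [pol_decode, hp]; rfl)
  have hcube : ∀ y, (namedElt s l, transv (decode y)) ∈ pairGroup s (List.range 14) →
      qMinus (decode y) = 1 → codePolar y (rootCode w) = true →
      (namedElt s l * namedElt s w) ^ 3 = 1 := by
    intro y hy hq hp
    refine congrArg Prod.fst (eq_one_of_mem_pairGroup hcox hz
      (pow_mem (mul_mem hy (hmem hw)) 3) ?_)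
    exact transv_cube hq hqw (by rw [pol_decode, hp]; rfl)
  have hl' : (namedElt s l, transv (decode (rootCode l))) ∈ pairGroup s (List.range 14) :=
    hmem (show l < 14 by omega)
  have heq : namedElt s l = namedElt s w := by
    refine eq_of_sq_of_cube (namedElt_mul_self hcox (show w < 16 by omega)) ?_ ?_
    · cases hc : codePolar x (rootCode w) with
      | false => exact hsq x hk hqx hc
      | true =>
        refine hsq _ hl' hql ?_
        rw [hc] at hsep
        exact Bool.eq_false_of_not_eq_true hsep.symm
    · cases hc : codePolar x (rootCode w) with
      | true => exact hcube x hk hqx hc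
      | false =>
        refine hcube _ hl' hql ?_
        rw [hc] at hsep
        exact Bool.eq_true_of_not_eq_false hsep.symm
  exact hwl (namedElt_injOn hG hgen hcox hw (show l < 14 by omega) heq.symm)

/-- A subgroup of a product that projects bijectively to both sides is the graph of an isomorphism.
-/
theorem nonempty_mulEquiv_O8Minus2 : Nonempty (G ≃* O8Minus2) := by
  let K := pairGroup s (List.range 14)
  let φ : K →* G := (MonoidHom.fst G (V8 ≃ₗ[ZMod 2] V8)).comp K.subtype
  let ψ : K →* O8Minus2 := ((MonoidHom.snd G (V8 ≃ₗ[ZMod 2] V8)).comp K.subtype).codRestrict _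
    fun k => snd_mem (fun g hg => by rw [List.mem_range] at hg; omega) k.2
  have hφ : Function.Bijective φ := by
    constructor
    · rw [injective_iff_map_eq_one]
      intro k hk
      exact Subtype.ext (eq_one_of_fst_eq_one hG hgen hcox hz k.2 hk)
    · rw [← MonoidHom.range_eq_top, eq_top_iff, ← hgen, Subgroup.closure_le]
      have key : ∀ l < 14, namedElt s l ∈ φ.range := fun l hl =>
        ⟨⟨pairElt s l, pairElt_mem (List.mem_range.2 hl)⟩, rfl⟩
      rintro _ ⟨_ | ⟨a, b⟩, rfl⟩
      · exact key 0 (by norm_num)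
      · fin_cases a <;> fin_cases b
        · exact key 1 (by norm_num)
        · exact key 2 (by norm_num)
        · exact key 3 (by norm_num)
        · exact key 4 (by norm_num)
        · exact key 5 (by norm_num)
        · exact key 6 (by norm_num)
        · exact key 7 (by norm_num)
        · exact key 8 (by norm_num)
        · exact key 9 (by norm_num)
  have hψ : Function.Bijective ψ := by
    constructor
    · rw [injective_iff_map_eq_one]
      intro k hk
      exact Subtype.ext (eq_one_of_mem_pairGroup hcox hz k.2 (congrArg Subtype.val hk))
    · rintro ⟨f, hf⟩
      obtain ⟨h, hh, rfl⟩ := exists_snd_eq (s := s) cosetTables (List.range 14) []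
        checkOrbits_cosetTables hf (by simp)
      exact ⟨⟨h, hh⟩, rfl⟩
  exact ⟨(MulEquiv.ofBijective φ hφ).symm.trans (MulEquiv.ofBijective ψ hψ)⟩

end Pairs

end Deflate

open Deflate in
theorem theorem2 {G : Type*} [Group G] (hG : 2 < ENat.card G)
    (s : Node → G) (hgen : Subgroup.closure (Set.range s) = ⊤)
    (hcox : SatisfiesCoxeter y333 s)
    (h14 : (closureNodes s).encard ≤ 14) :
    (closureNodes s).encard = 14 ∧
    Nonempty (closureGraph s ≃g fanoIncidence) ∧
    SatisfiesCoxeter (closureGraph s) (fun x => (x : G)) ∧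
    (zElt s 0 = zElt s 1 ∧ zElt s 1 = zElt s 2) ∧
    Nonempty (G ≃* O8Minus2) := by
  have hz : ∀ i j, 13 ≤ i → i < 16 → 13 ≤ j → j < 16 → namedElt s i = namedElt s j :=
    fun i j hi hi' hj hj' => namedElt_eq_of_closureNodes_le hG hgen hcox h14 hi hi' hj hj'
  exact ⟨(closureNodes_eq hG hgen hcox h14).2, nonempty_closureGraph_iso hG hgen hcox h14,
    satisfiesCoxeter_closureGraph hG hgen hcox h14,
    ⟨hz 13 14 (by norm_num) (by norm_num) (by norm_num) (by norm_num),
      hz 14 15 (by norm_num) (by norm_num) (by norm_num) (by norm_num)⟩,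
    nonempty_mulEquiv_O8Minus2 hG hgen hcox fun l hl hl' =>
      hz l 13 hl' hl (by norm_num) (by norm_num)⟩
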